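/- Let $m,n\ge 2$ be integers and $R=[0,m-1]\times[0,n-1]\subset\mathbb{R}^2$. The tiles are the following convex polygons, where $a,b$ are positive integers, and all their images under rotations by integer multiples of $\pi/2$ and arbitrary translations: the square of side $2$ with horizontal and vertical sides; the square of side $\sqrt2$ with diagonal sides (of slope $\pm1$); the right isosceles triangle with horizontal and vertical legs of length $a$; the isosceles trapezoid with horizontal bases of lengths $2a+2$ and $2$ and angles $\pi/4,\pi/4,3\pi/4,3\pi/4$; the hexagon with successive sides $2,a\sqrt2,2,2,a\sqrt2,2$, whose sides of length $2$ are horizontal or vertical, which has right angles between consecutive sides of length $2$ and angles $3\pi/4$ elsewhere; the octagon with successive sides $2,a\sqrt2,2,b\sqrt2,2,a\sqrt2,2,b\sqrt2$, all angles $3\pi/4$, and horizontal or vertical sides of length $2$. The legs of a triangle and the large base of a trapezoid are required to lie on the boundary of $R$. A tiling of $R$ is a set of tiles with pairwise disjoint interiors whose union is $R$. A point $(x,y)\in\mathbb{Z}^2$ is integral, and is black if $x+y$ is even and white if $x+y$ is odd. Then for every tiling of $R$, all vertices of its tiles are integral points, and, with the possible exception of the four corners of $R$, all vertices of its tiles have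 the same color. Moreover, call a tile black (resp. white) if all its vertices, disregarding the right-angle vertex in the case of a triangle, are black (resp. white), and let $\mathcal{T}_b$ (resp. $\mathcal{T}_w$) be the set of tilings of $R$ all of whose tiles are black (resp. white). Then the set $\mathcal{T}$ of all tilings of $R$ is the disjoint union $\mathcal{T}=\mathcal{T}_b\cup\mathcal{T}_w$. -/

import Mathlib

namespace SpecialTiling

/-- The Euclidean plane (only its affine and topological structure is used). -/
abbrev Plane : Type := ℝ × ℝ

/-- The rectangle `R = [0, m - 1] × [0, n - 1]`. -/
def rect (m n : ℕ) : Set Plane :=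
  Set.Icc (0 : ℝ) ((m : ℝ) - 1) ×ˢ Set.Icc (0 : ℝ) ((n : ℝ) - 1)

/-- The four corners of `R`. -/
def rectCorners (m n : ℕ) : Set Plane :=
  ({0, (m : ℝ) - 1} : Set ℝ) ×ˢ ({0, (n : ℝ) - 1} : Set ℝ)

/-- The shapes of the tiles; the parameters are positive integers. -/
inductive Shape : Type
  /-- The square of side `2` with horizontal and vertical sides. -/
  | square : Shape
  /-- The square of side `√2` with diagonal sides. -/
  | diamond : Shape
  /-- The right isosceles triangle with legs `a` and hypotenuse `a√2`. -/
  | triangle (a : ℕ+) : Shape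
  /-- The isosceles trapezoid with bases `2a + 2` and `2`, legs `a√2`. -/
  | trapezoid (a : ℕ+) : Shape
  /-- The hexagon with successive sides `2, a√2, 2, 2, a√2, 2` (right angles between consecutive
  sides of length `2`, the other four angles `3π/4`). -/
  | hexagon (a : ℕ+) : Shape
  /-- The octagon with successive sides `2, a√2, 2, b√2, 2, a√2, 2, b√2`, all angles `3π/4`. -/
  | octagon (a b : ℕ+) : Shape

/-- The corners of the shape in its standard position, in counterclockwise order. -/
def Shape.corners : Shape → List Plane
  | .square => [(0, 0), (2, 0), (2, 2), (0, 2)]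
  | .diamond => [(1, 0), (2, 1), (1, 2), (0, 1)]
  | .triangle a => [(0, 0), ((a : ℝ), 0), (0, (a : ℝ))]
  | .trapezoid a => [(0, 0), (2 * (a : ℝ) + 2, 0), ((a : ℝ) + 2, (a : ℝ)), ((a : ℝ), (a : ℝ))]
  | .hexagon a => [(0, 0), (2, 0), ((a : ℝ) + 2, (a : ℝ)), ((a : ℝ) + 2, (a : ℝ) + 2),
      ((a : ℝ), (a : ℝ) + 2), (0, 2)]
  | .octagon a b => [((b : ℝ), 0), ((b : ℝ) + 2, 0), ((a : ℝ) + b + 2, (a : ℝ)),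
      ((a : ℝ) + b + 2, (a : ℝ) + 2), ((a : ℝ) + 2, (a : ℝ) + b + 2), ((a : ℝ), (a : ℝ) + b + 2),
      (0, (b : ℝ) + 2), (0, (b : ℝ))]

/-- The dashed sides (given by their endpoints): the legs of a triangle and the large base of a
trapezoid. -/
def Shape.dashed : Shape → List (Plane × Plane)
  | .triangle a => [((0, 0), ((a : ℝ), 0)), ((0, 0), (0, (a : ℝ)))]
  | .trapezoid a => [((0, 0), (2 * (a : ℝ) + 2, 0))]
  | _ => []

/-- Rotation of the plane by `π/2` about the origin. -/
def quarterTurn (p : Plane) : Plane := (-p.2, p.1)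

/-- Rotation by `k` quarter turns followed by the translation by `v`. -/
def place (k : Fin 4) (v : Plane) (p : Plane) : Plane := v + quarterTurn^[(k : ℕ)] p

/-- The vertex set of a shape that has been rotated by `k` quarter turns and translated by `v`. -/
def placedVertices (s : Shape) (k : Fin 4) (v : Plane) : Set Plane :=
  {q | ∃ p ∈ s.corners, q = place k v p}

/-- `V` is the vertex set of a tile admissible in `R`: a rotated and translated shape whose dashed
sides lie on the boundary of `R`. A tile is a convex polygon and is recorded by the set `V` of its
vertices; as a region of the plane it is `convexHull ℝ V`. -/
def IsTile (m n : ℕ) (V : Set Plane) : Prop :=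
  ∃ (s : Shape) (k : Fin 4) (v : Plane), V = placedVertices s k v ∧
    ∀ e ∈ s.dashed, segment ℝ (place k v e.1) (place k v e.2) ⊆ frontier (rect m n)

/-- `T` is (the set of the vertex sets of the tiles of) a tiling of `R`: the tiles cover exactly
`R`, and distinct tiles have disjoint interiors. -/
structure IsTiling (m n : ℕ) (T : Set (Set Plane)) : Prop where
  isTile : ∀ V ∈ T, IsTile m n V
  cover : (⋃ V ∈ T, convexHull ℝ V) = rect m n
  disjoint : T.Pairwise fun V W =>
    Disjoint (interior (convexHull ℝ V)) (interior (convexHull ℝ W))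

/-- Points with integer coordinates. -/
def IsIntegralPoint (p : Plane) : Prop := ∃ x y : ℤ, p = ((x : ℝ), (y : ℝ))

/-- Integral points `(x, y)` with `x + y` even. -/
def IsBlack (p : Plane) : Prop := ∃ x y : ℤ, p = ((x : ℝ), (y : ℝ)) ∧ Even (x + y)

/-- Integral points `(x, y)` with `x + y` odd. -/
def IsWhite (p : Plane) : Prop := ∃ x y : ℤ, p = ((x : ℝ), (y : ℝ)) ∧ Odd (x + y)

/-- `p` is the right-angle vertex of the triangular tile with vertex set `V`. -/
def IsRightAngleVertex (V : Set Plane) (p : Plane) : Prop :=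
  ∃ (a : ℕ+) (k : Fin 4) (v : Plane), V = placedVertices (.triangle a) k v ∧ p = place k v (0, 0)

/-- A tile is black when its vertices are black, the right-angle vertex of a triangle being
disregarded. -/
def IsBlackTile (V : Set Plane) : Prop := ∀ p ∈ V, ¬ IsRightAngleVertex V p → IsBlack p

/-- A tile is white when its vertices are white, the right-angle vertex of a triangle being
disregarded. -/
def IsWhiteTile (V : Set Plane) : Prop := ∀ p ∈ V, ¬ IsRightAngleVertex V p → IsWhite p

/-- The set `𝒯` of all tilings of `R`. -/
def tilings (m n : ℕ) : Set (Set (Set Plane)) := {T | IsTiling m n T}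

/-- The set `𝒯_b` of the tilings of `R` all of whose tiles are black. -/
def blackTilings (m n : ℕ) : Set (Set (Set Plane)) :=
  {T | IsTiling m n T ∧ ∀ V ∈ T, IsBlackTile V}

/-- The set `𝒯_w` of the tilings of `R` all of whose tiles are white. -/
def whiteTilings (m n : ℕ) : Set (Set (Set Plane)) :=
  {T | IsTiling m n T ∧ ∀ V ∈ T, IsWhiteTile V}

end SpecialTiling

namespace SpecialTiling
open Filter Topology

/-! Every tile is an octagon with normals `dir 0, ..., dir 7`, some of its sides possibly of length
zero, and apart from the right-angle vertex of a triangle its vertices differ by black vectors. So a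
tile has a class in the plane modulo the black points, and the theorem follows once all tiles of a
tiling have the same class. Integrality is not assumed on the way: it comes from the corner `0` of
`R`, an extreme point and hence a vertex of some tile.

Equality of classes is proved locally, with no analysis of how tiles can meet at a point. Around a
point `x` inside `R` there are eight sectors of angle π/4, and each is filled near `x` by exactly
one tile (`sum_sectorInd`). For a class `c`, count the tiles of class `c` that fill sector `k`.
Passing from sector `k - 1` to sector `k` changes the count only through sides that lie on the line
through `x` along `dir k` (`sectorInd_sub`). On that line the sides of all tiles form signed
half-open intervals whose total is zero. Each interval has endpoints of the class of its tile, so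
jumps of different classes occur at different points and cannot cancel; hence the total over class
`c` alone is zero too (`sum_intervals_class_eq_zero`). The count is therefore the same for all eight
sectors, and tiles that meet at `x` share their class (`ClassedTiling.cls_eq_of_mem`). Connectedness
of the interior of `R` then gives `ClassedTiling.cls_eq`.

The legs of triangles, the only sides that may end at a vertex of another class, lie on the boundary
of `R`, so lines through them miss the interior. For the same reason the right-angle vertices are
corners of `R`. -/

@[elab_as_elim]
theorem fin_eight_cases {P : Fin 8 → Prop} (h0 : P 0) (h1 : P 1) (h2 : P 2) (h3 : P 3) (h4 : P 4)
    (h5 : P 5) (h6 : P 6) (h7 : P 7) (i : Fin 8) : P i := by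
  fin_cases i <;> assumption

@[simp] theorem fin_eight_neg_one : (-1 : Fin 8) = 7 := rfl

@[simp] theorem fin_eight_neg_two : (-2 : Fin 8) = 6 := rfl

@[simp] theorem fin_eight_neg_four : (-4 : Fin 8) = 4 := rfl

@[simp] theorem fin_eight_neg_six : (-6 : Fin 8) = 2 := rfl

/-! ### Octagonal regions with eight fixed normals -/

/-- The eight outer normal directions of an octagonal region, in counterclockwise order. -/
def dir : Fin 8 → Plane :=
  ![(1, 0), (1, 1), (0, 1), (-1, 1), (-1, 0), (-1, -1), (0, -1), (1, -1)]

/-- The linear functional with gradient `dir i`. -/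
def ell (i : Fin 8) (p : Plane) : ℝ := (dir i).1 * p.1 + (dir i).2 * p.2

/-- The coordinate along `dir k`, normalized to take the value `1` at `dir k`. -/
noncomputable def coord (k : Fin 8) (p : Plane) : ℝ := (![1, 1/2, 1, 1/2, 1, 1/2, 1, 1/2] : Fin 8 → ℝ) k * ell k p

/-- The octagonal region cut out by the inequalities `ell i p ≤ b i`. -/
def poly (b : Fin 8 → ℝ) : Set Plane := {p | ∀ i, ell i p ≤ b i}

/-- The points satisfying all the inequalities of `poly b` strictly. -/
def inner (b : Fin 8 → ℝ) : Set Plane := {p | ∀ i, ell i p < b i}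

/-- The intersection of the lines supporting sides `i` and `i + 1`. -/
def vert (b : Fin 8 → ℝ) : Fin 8 → Plane :=
  ![(b 0, b 1 - b 0), (b 1 - b 2, b 2), (b 2 - b 3, b 2), (-b 4, b 3 - b 4),
    (-b 4, b 4 - b 5), (b 6 - b 5, -b 6), (b 7 - b 6, -b 6), (b 0, b 0 - b 7)]

/-- The length of side `i` as a multiple of `dir (i + 2)`. -/
def sideLen (b : Fin 8 → ℝ) : Fin 8 → ℝ :=
  ![b 1 + b 7 - 2 * b 0, b 2 + b 0 - b 1, b 3 + b 1 - 2 * b 2, b 4 + b 2 - b 3,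
    b 5 + b 3 - 2 * b 4, b 6 + b 4 - b 5, b 7 + b 5 - 2 * b 6, b 0 + b 6 - b 7]

theorem ell_zero (p : Plane) : ell 0 p = p.1 := by simp [ell, dir]

theorem ell_one (p : Plane) : ell 1 p = p.1 + p.2 := by simp [ell, dir]

theorem ell_two (p : Plane) : ell 2 p = p.2 := by simp [ell, dir]

theorem ell_three (p : Plane) : ell 3 p = -p.1 + p.2 := by simp [ell, dir]

theorem ell_four (p : Plane) : ell 4 p = -p.1 := by simp [ell, dir]

theorem ell_five (p : Plane) : ell 5 p = -p.1 - p.2 := by simp [ell, dir]; ring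

theorem ell_six (p : Plane) : ell 6 p = -p.2 := by simp [ell, dir]

theorem ell_seven (p : Plane) : ell 7 p = p.1 - p.2 := by simp [ell, dir]; ring

theorem coord_zero (p : Plane) : coord 0 p = p.1 := by
  simp [coord, ell, dir]

theorem coord_one (p : Plane) : coord 1 p = (p.1 + p.2) / 2 := by
  simp [coord, ell, dir]; ring

theorem coord_two (p : Plane) : coord 2 p = p.2 := by
  simp [coord, ell, dir]

theorem coord_three (p : Plane) : coord 3 p = (-p.1 + p.2) / 2 := by
  simp [coord, ell, dir]; ring

theorem coord_four (p : Plane) : coord 4 p = -p.1 := by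
  simp [coord, ell, dir]

theorem coord_five (p : Plane) : coord 5 p = (-p.1 - p.2) / 2 := by
  simp [coord, ell, dir]; ring

theorem coord_six (p : Plane) : coord 6 p = -p.2 := by
  simp [coord, ell, dir]

theorem coord_seven (p : Plane) : coord 7 p = (p.1 - p.2) / 2 := by
  simp [coord, ell, dir]; ring

theorem vert_zero (b : Fin 8 → ℝ) : vert b 0 = (b 0, b 1 - b 0) := rfl

theorem vert_one (b : Fin 8 → ℝ) : vert b 1 = (b 1 - b 2, b 2) := rfl

theorem vert_two (b : Fin 8 → ℝ) : vert b 2 = (b 2 - b 3, b 2) := rfl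

theorem vert_three (b : Fin 8 → ℝ) : vert b 3 = (-b 4, b 3 - b 4) := rfl

theorem vert_four (b : Fin 8 → ℝ) : vert b 4 = (-b 4, b 4 - b 5) := rfl

theorem vert_five (b : Fin 8 → ℝ) : vert b 5 = (b 6 - b 5, -b 6) := rfl

theorem vert_six (b : Fin 8 → ℝ) : vert b 6 = (b 7 - b 6, -b 6) := rfl

theorem vert_seven (b : Fin 8 → ℝ) : vert b 7 = (b 0, b 0 - b 7) := rfl

theorem continuous_ell (i : Fin 8) : Continuous (ell i) := by unfold ell; fun_prop

theorem ell_add (i : Fin 8) (p q : Plane) : ell i (p + q) = ell i p + ell i q := by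
  simp only [ell, Prod.fst_add, Prod.snd_add]; ring

theorem ell_sub (i : Fin 8) (p q : Plane) : ell i (p - q) = ell i p - ell i q := by
  simp only [ell, Prod.fst_sub, Prod.snd_sub]; ring

theorem ell_smul (i : Fin 8) (t : ℝ) (p : Plane) : ell i (t • p) = t * ell i p := by
  simp only [ell, Prod.smul_fst, Prod.smul_snd, smul_eq_mul]; ring

theorem ell_opposite (k : Fin 8) (p : Plane) : ell (k - 2) p = -ell (k + 2) p := by
  induction k using fin_eight_cases <;> simp [ell, dir] <;> ring

theorem ell_perp (k : Fin 8) : ell (k + 2) (dir k) = 0 := by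
  induction k using fin_eight_cases <;> simp [ell, dir]

theorem isClosed_poly (b : Fin 8 → ℝ) : IsClosed (poly b) := by
  simp only [poly, Set.ofPred_forall]
  exact isClosed_iInter fun i => isClosed_le (continuous_ell i) continuous_const

theorem isOpen_inner (b : Fin 8 → ℝ) : IsOpen (inner b) := by
  simp only [inner, Set.ofPred_forall]
  exact isOpen_iInter_of_finite fun i => isOpen_lt (continuous_ell i) continuous_const

theorem inner_subset_poly (b : Fin 8 → ℝ) : inner b ⊆ poly b := fun _ hp i => (hp i).le

theorem convex_poly (b : Fin 8 → ℝ) : Convex ℝ (poly b) := by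
  intro p hp q hq s t hs ht hst i
  rw [ell_add, ell_smul, ell_smul]
  have h1 := mul_le_mul_of_nonneg_left (hp i) hs
  have h2 := mul_le_mul_of_nonneg_left (hq i) ht
  calc s * ell i p + t * ell i q ≤ s * b i + t * b i := add_le_add h1 h2
    _ = b i := by rw [← add_mul, hst, one_mul]

theorem sideLen_bounds {b : Fin 8 → ℝ} (h : ∀ i, 0 ≤ sideLen b i) :
    (0 ≤ b 1 + b 7 - 2 * b 0 ∧ 0 ≤ b 2 + b 0 - b 1 ∧ 0 ≤ b 3 + b 1 - 2 * b 2 ∧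
      0 ≤ b 4 + b 2 - b 3) ∧
    0 ≤ b 5 + b 3 - 2 * b 4 ∧ 0 ≤ b 6 + b 4 - b 5 ∧ 0 ≤ b 7 + b 5 - 2 * b 6 ∧
      0 ≤ b 0 + b 6 - b 7 :=
  ⟨⟨h 0, h 1, h 2, h 3⟩, h 4, h 5, h 6, h 7⟩

theorem vert_mem_poly {b : Fin 8 → ℝ} (h : ∀ i, 0 ≤ sideLen b i) (i : Fin 8) :
    vert b i ∈ poly b := by
  obtain ⟨⟨h0, h1, h2, h3⟩, h4, h5, h6, h7⟩ := sideLen_bounds h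
  intro j
  induction i using fin_eight_cases <;> induction j using fin_eight_cases <;> simp [vert, ell, dir] <;> linarith

theorem mem_segment_of_eq_add {p A B d : Plane} {s L : ℝ} (hp : p = A + s • d) (hB : B = A + L • d)
    (hs : 0 ≤ s) (hL : s ≤ L) : p ∈ segment ℝ A B := by
  rcases hs.eq_or_lt with rfl | hs'
  · rw [hp, zero_smul, add_zero]; exact left_mem_segment ℝ A B
  · have hL0 : 0 < L := hs'.trans_le hL
    refine ⟨1 - s / L, s / L, ?_, by positivity, by ring, ?_⟩
    · rw [sub_nonneg, div_le_one hL0]; exact hL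
    · rw [hB, hp, smul_add, smul_smul, div_mul_cancel₀ _ hL0.ne', ← add_assoc, ← add_smul]
      simp

theorem vert_eq_add (b : Fin 8 → ℝ) (i : Fin 8) :
    vert b i = vert b (i - 1) + sideLen b i • dir (i + 2) := by
  induction i using fin_eight_cases <;> simp [vert, sideLen, dir] <;> ring_nf

/-- On the line supporting side `i`, the two neighbouring inequalities `i - 1` and `i + 1` already
cut out the side. -/
theorem mem_segment_of_ell_eq {b : Fin 8 → ℝ} {p : Plane} (hp : p ∈ poly b) {i : Fin 8}
    (hi : ell i p = b i) : p ∈ segment ℝ (vert b (i - 1)) (vert b i) := by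
  have h1 := hp (i - 1)
  have h2 := hp (i + 1)
  refine mem_segment_of_eq_add (s := coord (i + 2) p - coord (i + 2) (vert b (i - 1))) (p := p) ?_
    (vert_eq_add b i) ?_ ?_
  · induction i using fin_eight_cases <;> simp [coord, ell, dir, vert] at * <;> ext <;> simp <;> linarith
  · induction i using fin_eight_cases <;> simp [coord, ell, dir, vert] at * <;> linarith
  · induction i using fin_eight_cases <;> simp [coord, ell, dir, vert, sideLen] at * <;> linarith

theorem convexHull_range_vert {b : Fin 8 → ℝ} (h : ∀ i, 0 ≤ sideLen b i) :
    convexHull ℝ (Set.range (vert b)) = poly b := by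
  apply Set.Subset.antisymm
  · exact convexHull_min (Set.range_subset_iff.2 (vert_mem_poly h)) (convex_poly b)
  · have hc := convex_convexHull ℝ (Set.range (vert b))
    have hv : ∀ i, vert b i ∈ convexHull ℝ (Set.range (vert b)) := fun i =>
      subset_convexHull ℝ _ (Set.mem_range_self i)
    have hside : ∀ p ∈ poly b, ∀ i, ell i p = b i → p ∈ convexHull ℝ (Set.range (vert b)) :=
      fun p hp i hi => hc.segment_subset (hv _) (hv _) (mem_segment_of_ell_eq hp hi)
    rintro ⟨x, y⟩ hp
    have e0 := hp 0
    have e1 := hp 1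
    have e2 := hp 2
    have e3 := hp 3
    have e4 := hp 4
    have e5 := hp 5
    have e6 := hp 6
    have e7 := hp 7
    simp [ell, dir] at e0 e1 e2 e3 e4 e5 e6 e7
    -- The horizontal line through the point leaves the region on the left at the largest of the
    -- three bounds with normals pointing left, and so on a side; likewise on the right. The point
    -- lies between these two exits.
    obtain ⟨l, hlx, h3, h4, h5, hl⟩ : ∃ l, l ≤ x ∧ -l + y ≤ b 3 ∧ -l ≤ b 4 ∧ -l - y ≤ b 5 ∧
        (-l + y = b 3 ∨ -l = b 4 ∨ -l - y = b 5) := by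
      rcases le_total (y - b 3) (-b 4) with h | h
      · rcases le_total (-b 4) (-y - b 5) with h' | h'
        · exact ⟨-y - b 5, by linarith, by linarith, by linarith, by linarith, by grind⟩
        · exact ⟨-b 4, by linarith, by linarith, by linarith, by linarith, by grind⟩
      · rcases le_total (y - b 3) (-y - b 5) with h' | h'
        · exact ⟨-y - b 5, by linarith, by linarith, by linarith, by linarith, by grind⟩
        · exact ⟨y - b 3, by linarith, by linarith, by linarith, by linarith, by grind⟩
    obtain ⟨r, hrx, h0, h1, h7, hr⟩ : ∃ r, x ≤ r ∧ r ≤ b 0 ∧ r + y ≤ b 1 ∧ r - y ≤ b 7 ∧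
        (r = b 0 ∨ r + y = b 1 ∨ r - y = b 7) := by
      rcases le_total (b 0) (b 1 - y) with h | h
      · rcases le_total (b 0) (b 7 + y) with h' | h'
        · exact ⟨b 0, by linarith, by linarith, by linarith, by linarith, by grind⟩
        · exact ⟨b 7 + y, by linarith, by linarith, by linarith, by linarith, by grind⟩
      · rcases le_total (b 1 - y) (b 7 + y) with h' | h'
        · exact ⟨b 1 - y, by linarith, by linarith, by linarith, by linarith, by grind⟩
        · exact ⟨b 7 + y, by linarith, by linarith, by linarith, by linarith, by grind⟩
    have hlp : ((l, y) : Plane) ∈ poly b := by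
      intro i; induction i using fin_eight_cases <;> simp [ell, dir] <;> linarith
    have hrp : ((r, y) : Plane) ∈ poly b := by
      intro i; induction i using fin_eight_cases <;> simp [ell, dir] <;> linarith
    have hl' : ((l, y) : Plane) ∈ convexHull ℝ (Set.range (vert b)) := by
      rcases hl with hl | hl | hl
      · exact hside _ hlp 3 (by simp [ell, dir]; linarith)
      · exact hside _ hlp 4 (by simp [ell, dir]; linarith)
      · exact hside _ hlp 5 (by simp [ell, dir]; linarith)
    have hr' : ((r, y) : Plane) ∈ convexHull ℝ (Set.range (vert b)) := by
      rcases hr with hr | hr | hr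
      · exact hside _ hrp 0 (by simp [ell, dir]; linarith)
      · exact hside _ hrp 1 (by simp [ell, dir]; linarith)
      · exact hside _ hrp 7 (by simp [ell, dir]; linarith)
    refine hc.segment_subset hl' hr' (mem_segment_of_eq_add (d := (1, 0)) (s := x - l) (L := r - l)
      ?_ ?_ (by linarith) (by linarith)) <;> simp

/-! ### Sectors at a point -/

/-- The half-open version of `poly b` that contains `p` when `p` has a small angular sector
between `dir k` and `dir (k + 1)` inside `poly b`. -/
def sector (k : Fin 8) (b : Fin 8 → ℝ) : Set Plane :=
  {p | p ∈ poly b ∧ ell (k - 1) p < b (k - 1) ∧ ell k p < b k ∧ ell (k + 1) p < b (k + 1) ∧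
    ell (k + 2) p < b (k + 2)}

theorem ell_sector_dir (k i : Fin 8) : ell i (dir k + dir (k + 1)) < 0 ∨
    i = k - 1 ∨ i = k ∨ i = k + 1 ∨ i = k + 2 := by
  induction k using fin_eight_cases <;> induction i using fin_eight_cases <;> simp [ell, dir] <;> norm_num

theorem ell_sector_dir_pos (k : Fin 8) :
    0 < ell (k - 1) (dir k + dir (k + 1)) ∧ 0 < ell k (dir k + dir (k + 1)) ∧
      0 < ell (k + 1) (dir k + dir (k + 1)) ∧ 0 < ell (k + 2) (dir k + dir (k + 1)) := by
  induction k using fin_eight_cases <;> simp [ell, dir] <;> norm_num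

theorem eventually_mem_inner {k : Fin 8} {b : Fin 8 → ℝ} {p : Plane} (hp : p ∈ sector k b) :
    ∀ᶠ ε : ℝ in 𝓝[>] 0, p + ε • (dir k + dir (k + 1)) ∈ inner b := by
  simp only [inner, Set.mem_ofPred_eq, eventually_all]
  intro i
  obtain ⟨hp0, h1, h2, h3, h4⟩ := hp
  rcases ell_sector_dir k i with h | h
  · filter_upwards [self_mem_nhdsWithin] with ε hε
    rw [ell_add, ell_smul]
    have := mul_neg_of_pos_of_neg (Set.mem_Ioi.1 hε) h
    linarith [hp0 i]
  · have hi : ell i p < b i := by rcases h with rfl | rfl | rfl | rfl <;> assumption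
    have hc : Tendsto (fun ε : ℝ => ell i (p + ε • (dir k + dir (k + 1)))) (𝓝[>] 0)
        (𝓝 (ell i (p + (0 : ℝ) • (dir k + dir (k + 1))))) :=
      (((continuous_ell i).comp (by fun_prop)).tendsto 0).mono_left nhdsWithin_le_nhds
    rw [zero_smul, add_zero] at hc
    exact hc.eventually (gt_mem_nhds hi)

theorem mem_sector_of_frequently {k : Fin 8} {b : Fin 8 → ℝ} {p : Plane}
    (hp : ∃ᶠ ε : ℝ in 𝓝[>] 0, p + ε • (dir k + dir (k + 1)) ∈ poly b) : p ∈ sector k b := by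
  have hc : Tendsto (fun ε : ℝ => p + ε • (dir k + dir (k + 1))) (𝓝[>] 0)
      (𝓝 (p + (0 : ℝ) • (dir k + dir (k + 1)))) :=
    ((by fun_prop : Continuous fun ε : ℝ => p + ε • (dir k + dir (k + 1))).tendsto 0).mono_left
      nhdsWithin_le_nhds
  rw [zero_smul, add_zero] at hc
  have hp0 : p ∈ poly b := (isClosed_poly b).mem_of_frequently_of_tendsto hp hc
  obtain ⟨ε, hε, hpos⟩ := (hp.and_eventually self_mem_nhdsWithin).exists
  have key : ∀ i, (i = k - 1 ∨ i = k ∨ i = k + 1 ∨ i = k + 2) → ell i p < b i := by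
    intro i hi
    have h := hε i
    rw [ell_add, ell_smul] at h
    have hu : 0 < ell i (dir k + dir (k + 1)) := by
      obtain ⟨h1, h2, h3, h4⟩ := ell_sector_dir_pos k
      rcases hi with rfl | rfl | rfl | rfl <;> assumption
    have := mul_pos (Set.mem_Ioi.1 hpos) hu
    linarith
  exact ⟨hp0, key _ (by simp), key _ (by simp), key _ (by simp), key _ (by simp)⟩

/-- The four inequalities describe the closed cone spanned by `dir k` and `dir (k + 1)`; these eight
cones cover the plane. -/
theorem exists_sector_dir (u : Plane) :
    ∃ k, 0 ≤ ell (k - 1) u ∧ 0 ≤ ell k u ∧ 0 ≤ ell (k + 1) u ∧ 0 ≤ ell (k + 2) u := by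
  obtain ⟨x, y⟩ := u
  rcases le_total 0 x with hx | hx <;> rcases le_total 0 y with hy | hy
  · rcases le_total x y with h | h
    · refine ⟨1, ?_⟩; simp [ell, dir]; exact ⟨by linarith, by linarith, by linarith, by linarith⟩
    · refine ⟨0, ?_⟩; simp [ell, dir]; exact ⟨by linarith, by linarith, by linarith, by linarith⟩
  · rcases le_total x (-y) with h | h
    · refine ⟨6, ?_⟩; simp [ell, dir]; exact ⟨by linarith, by linarith, by linarith, by linarith⟩
    · refine ⟨7, ?_⟩; simp [ell, dir]; exact ⟨by linarith, by linarith, by linarith, by linarith⟩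
  · rcases le_total (-x) y with h | h
    · refine ⟨2, ?_⟩; simp [ell, dir]; exact ⟨by linarith, by linarith, by linarith, by linarith⟩
    · refine ⟨3, ?_⟩; simp [ell, dir]; exact ⟨by linarith, by linarith, by linarith, by linarith⟩
  · rcases le_total (-x) (-y) with h | h
    · refine ⟨5, ?_⟩; simp [ell, dir]; exact ⟨by linarith, by linarith, by linarith, by linarith⟩
    · refine ⟨4, ?_⟩; simp [ell, dir]; exact ⟨by linarith, by linarith, by linarith, by linarith⟩

/-- The sector that points from `p` towards the interior point `z` works: its four functionals do
not decrease from `p` to `z`, where they are strictly below their bounds. -/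
theorem exists_mem_sector {b : Fin 8 → ℝ} {p z : Plane} (hp : p ∈ poly b) (hz : z ∈ inner b) :
    ∃ k, p ∈ sector k b := by
  obtain ⟨k, h⟩ := exists_sector_dir (z - p)
  simp only [ell_sub] at h
  obtain ⟨h1, h2, h3, h4⟩ := h
  exact ⟨k, hp, by linarith [hz (k - 1)], by linarith [hz k], by linarith [hz (k + 1)],
    by linarith [hz (k + 2)]⟩

/-- The inequalities common to `sector k b` and `sector (k - 1) b`. -/
def Straddles (k : Fin 8) (b : Fin 8 → ℝ) (p : Plane) : Prop :=
  (ell (k - 1) p < b (k - 1) ∧ ell k p < b k ∧ ell (k + 1) p < b (k + 1)) ∧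
    ell (k + 3) p ≤ b (k + 3) ∧ ell (k + 4) p ≤ b (k + 4) ∧ ell (k + 5) p ≤ b (k + 5)

theorem forall_fin_eight_shift {P : Fin 8 → Prop} (k : Fin 8) : (∀ i, P i) ↔
    P (k - 2) ∧ P (k - 1) ∧ P k ∧ P (k + 1) ∧ P (k + 2) ∧ P (k + 3) ∧ P (k + 4) ∧ P (k + 5) := by
  refine ⟨fun h => ⟨h _, h _, h _, h _, h _, h _, h _, h _⟩, fun h i => ?_⟩
  induction k using fin_eight_cases <;> 
    simp only [Fin.reduceAdd, Fin.reduceSub] at h <;>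
    induction i using fin_eight_cases <;> tauto

/-- Together with `mem_sector_sub_one_iff` this shows that crossing the ray along `dir k` only
exchanges which of the two parallel bounds `k + 2` and `k - 2` is strict. -/
theorem mem_sector_iff {k : Fin 8} {b : Fin 8 → ℝ} {p : Plane} : p ∈ sector k b ↔
    Straddles k b p ∧ ell (k + 2) p < b (k + 2) ∧ ell (k - 2) p ≤ b (k - 2) := by
  simp only [sector, poly, Set.mem_ofPred_eq, Straddles, forall_fin_eight_shift k]
  constructor
  · tauto
  · rintro ⟨⟨⟨h1, h2, h3⟩, h4, h5, h6⟩, h7, h8⟩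
    refine ⟨⟨?_, ?_, ?_, ?_, ?_, ?_, ?_, ?_⟩, ?_, ?_, ?_, ?_⟩ <;>
      first | assumption | (apply le_of_lt; assumption)

theorem mem_sector_sub_one_iff {k : Fin 8} {b : Fin 8 → ℝ} {p : Plane} : p ∈ sector (k - 1) b ↔
    Straddles k b p ∧ ell (k + 2) p ≤ b (k + 2) ∧ ell (k - 2) p < b (k - 2) := by
  have e1 : k - 1 - 1 = k - 2 := by induction k using fin_eight_cases <;> rfl
  have e2 : k - 1 + 1 = k := by induction k using fin_eight_cases <;> rfl
  have e3 : k - 1 + 2 = k + 1 := by induction k using fin_eight_cases <;> rfl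
  simp only [sector, poly, Set.mem_ofPred_eq, Straddles, forall_fin_eight_shift k, e1, e2, e3]
  constructor
  · tauto
  · rintro ⟨⟨⟨h1, h2, h3⟩, h4, h5, h6⟩, h7, h8⟩
    refine ⟨⟨?_, ?_, ?_, ?_, ?_, ?_, ?_, ?_⟩, ?_, ?_, ?_, ?_⟩ <;>
      first | assumption | (apply le_of_lt; assumption)

/-- Side `k - 2` is traversed in the direction `dir k`. The strict inequalities belong to the
normals pointing forward, so its far end is excluded and its near end kept. Side `k + 2`, in
`straddles_iff_left`, is traversed backwards, which swaps the roles of its two vertices. -/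
theorem straddles_iff_right {b : Fin 8 → ℝ} (h : ∀ i, 0 ≤ sideLen b i) {k : Fin 8} {p : Plane}
    (hp : ell (k - 2) p = b (k - 2)) : Straddles k b p ↔
      coord k (vert b (k - 3)) ≤ coord k p ∧ coord k p < coord k (vert b (k - 2)) := by
  obtain ⟨⟨h0, h1, h2, h3⟩, h4, h5, h6, h7⟩ := sideLen_bounds h
  clear h
  constructor
  · rintro ⟨⟨a1, a2, a3⟩, a4, a5, a6⟩
    constructor <;> induction k using fin_eight_cases <;>
      simp only [Fin.reduceAdd, Fin.reduceSub, ell_zero, ell_one, ell_two, ell_three, ell_four,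
        ell_five, ell_six, ell_seven, coord_zero, coord_one, coord_two, coord_three, coord_four,
        coord_five, coord_six, coord_seven, vert_zero, vert_one, vert_two, vert_three, vert_four,
        vert_five, vert_six, vert_seven] at * <;>
      linarith
  · rintro ⟨a1, a2⟩
    refine ⟨⟨?_, ?_, ?_⟩, ?_, ?_, ?_⟩ <;> induction k using fin_eight_cases <;>
      simp only [Fin.reduceAdd, Fin.reduceSub, ell_zero, ell_one, ell_two, ell_three, ell_four,
        ell_five, ell_six, ell_seven, coord_zero, coord_one, coord_two, coord_three, coord_four,
        coord_five, coord_six, coord_seven, vert_zero, vert_one, vert_two, vert_three, vert_four,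
        vert_five, vert_six, vert_seven] at * <;>
      linarith

theorem straddles_iff_left {b : Fin 8 → ℝ} (h : ∀ i, 0 ≤ sideLen b i) {k : Fin 8} {p : Plane}
    (hp : ell (k + 2) p = b (k + 2)) : Straddles k b p ↔
      coord k (vert b (k + 2)) ≤ coord k p ∧ coord k p < coord k (vert b (k + 1)) := by
  obtain ⟨⟨h0, h1, h2, h3⟩, h4, h5, h6, h7⟩ := sideLen_bounds h
  clear h
  constructor
  · rintro ⟨⟨a1, a2, a3⟩, a4, a5, a6⟩
    constructor <;> induction k using fin_eight_cases <;>
      simp only [Fin.reduceAdd, Fin.reduceSub, ell_zero, ell_one, ell_two, ell_three, ell_four,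
        ell_five, ell_six, ell_seven, coord_zero, coord_one, coord_two, coord_three, coord_four,
        coord_five, coord_six, coord_seven, vert_zero, vert_one, vert_two, vert_three, vert_four,
        vert_five, vert_six, vert_seven] at * <;>
      linarith
  · rintro ⟨a1, a2⟩
    refine ⟨⟨?_, ?_, ?_⟩, ?_, ?_, ?_⟩ <;> induction k using fin_eight_cases <;>
      simp only [Fin.reduceAdd, Fin.reduceSub, ell_zero, ell_one, ell_two, ell_three, ell_four,
        ell_five, ell_six, ell_seven, coord_zero, coord_one, coord_two, coord_three, coord_four,
        coord_five, coord_six, coord_seven, vert_zero, vert_one, vert_two, vert_three, vert_four,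
        vert_five, vert_six, vert_seven] at * <;>
      linarith

/-! ### Signed sums of half-open intervals on a line -/

/-- A single `t` slightly below `z` computes the left limits at `z` of finitely many interval
indicators at once. -/
theorem exists_left_limit {ι : Type*} (I : Finset ι) (p q : ι → ℝ) (z : ℝ) :
    ∃ t, ∀ i ∈ I, (p i ≤ t ∧ t < q i) = (p i < z ∧ z ≤ q i) := by
  have h : ∀ᶠ t in 𝓝[<] z, ∀ i ∈ I, (p i ≤ t ∧ t < q i) = (p i < z ∧ z ≤ q i) := by
    rw [Filter.eventually_all_finset]
    intro i _
    have h1 : ∀ᶠ t in 𝓝[<] z, (p i ≤ t ↔ p i < z) := by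
      rcases lt_or_ge (p i) z with h | h
      · filter_upwards [mem_nhdsWithin_of_mem_nhds (Ioi_mem_nhds h)] with t ht
        exact ⟨fun _ => h, fun _ => (Set.mem_Ioi.1 ht).le⟩
      · filter_upwards [self_mem_nhdsWithin] with t ht
        have := Set.mem_Iio.1 ht
        constructor <;> intro <;> linarith
    have h2 : ∀ᶠ t in 𝓝[<] z, (t < q i ↔ z ≤ q i) := by
      rcases lt_or_ge (q i) z with h | h
      · filter_upwards [mem_nhdsWithin_of_mem_nhds (Ioi_mem_nhds h)] with t ht
        have := Set.mem_Ioi.1 ht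
        constructor <;> intro <;> linarith
      · filter_upwards [self_mem_nhdsWithin] with t ht
        exact ⟨fun _ => h, fun _ => (Set.mem_Iio.1 ht).trans_le h⟩
    filter_upwards [h1, h2] with t h1 h2
    rw [propext h1, propext h2]
  exact h.exists

theorem ite_interval_sub {p q z : ℝ} (h : p ≤ q) :
    (if p ≤ z ∧ z < q then (1 : ℤ) else 0) - (if p < z ∧ z ≤ q then 1 else 0) =
      (if p = z then 1 else 0) - (if q = z then 1 else 0) := by
  rcases lt_trichotomy p z with h1 | h1 | h1 <;> rcases lt_trichotomy q z with h2 | h2 | h2 <;>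
    grind

/-- If a signed sum of indicators of half-open intervals vanishes, and the endpoints of each
interval have the same class as the interval, then the partial sum over each class vanishes. -/
theorem sum_intervals_class_eq_zero {ι C : Type*} [DecidableEq C] (I : Finset ι) (s : ι → ℤ)
    (p q : ι → ℝ) (cl : ι → C) (γ : ℝ → C) (hpq : ∀ i ∈ I, p i ≤ q i)
    (hcl : ∀ i ∈ I, s i = 0 ∨ p i = q i ∨ γ (p i) = cl i ∧ γ (q i) = cl i)
    (h0 : ∀ t, ∑ i ∈ I, s i * (if p i ≤ t ∧ t < q i then 1 else 0) = 0) (c : C) (t : ℝ) :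
    ∑ i ∈ I, (if cl i = c then s i * (if p i ≤ t ∧ t < q i then 1 else 0) else 0) = 0 := by
  -- The jump at `z` is the value there minus the left limit, and both vanish by `h0`.
  have jump : ∀ z, ∑ i ∈ I, s i * ((if p i = z then 1 else 0) - (if q i = z then 1 else 0)) = 0 := by
    intro z
    obtain ⟨u, hu⟩ := exists_left_limit I p q z
    have h1 := h0 z
    have h2 := h0 u
    have h3 := sub_eq_zero.2 (h1.trans h2.symm)
    rw [← Finset.sum_sub_distrib] at h3
    refine Eq.trans (Finset.sum_congr rfl fun i hi => ?_) h3
    simp only [← mul_sub, hu i hi, ite_interval_sub (hpq i hi)]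
  -- If `z` has class `c`, intervals of other classes contribute nothing at `z`, so this is the full
  -- jump. Otherwise no interval of class `c` contributes.
  have classJump : ∀ z, ∑ i ∈ I, (if cl i = c then
      s i * ((if p i = z then 1 else 0) - (if q i = z then 1 else 0)) else 0) = 0 := by
    intro z
    by_cases hz : γ z = c
    · refine Eq.trans (Finset.sum_congr rfl fun i hi => ?_) (jump z)
      by_cases h1 : cl i = c
      · rw [if_pos h1]
      · rw [if_neg h1]
        rcases hcl i hi with h2 | h2 | ⟨h2, h3⟩
        · simp [h2]
        · simp [h2]
        · rw [if_neg (fun e => h1 (by rw [← h2, e, hz])), if_neg (fun e => h1 (by rw [← h3, e, hz]))]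
          simp
    · refine Finset.sum_eq_zero fun i hi => ?_
      have := hcl i hi
      grind
  -- An indicator is recovered at `t` by adding up its jumps at all points up to `t`.
  have expand : ∀ i ∈ I, (if p i ≤ t ∧ t < q i then (1 : ℤ) else 0) =
      ∑ z ∈ (I.image p ∪ I.image q).filter (· ≤ t),
        ((if p i = z then 1 else 0) - (if q i = z then 1 else 0)) := by
    intro i hi
    rw [Finset.sum_sub_distrib, Finset.sum_ite_eq, Finset.sum_ite_eq]
    have h1 : p i ∈ I.image p ∪ I.image q :=
      Finset.mem_union_left _ (Finset.mem_image_of_mem _ hi)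
    have h2 : q i ∈ I.image p ∪ I.image q :=
      Finset.mem_union_right _ (Finset.mem_image_of_mem _ hi)
    simp only [Finset.mem_filter, h1, h2, true_and]
    have := hpq i hi
    grind
  calc _ = ∑ i ∈ I, ∑ z ∈ (I.image p ∪ I.image q).filter (· ≤ t), (if cl i = c then
        s i * ((if p i = z then 1 else 0) - (if q i = z then 1 else 0)) else 0) := by
        refine Finset.sum_congr rfl fun i hi => ?_
        rw [expand i hi, Finset.mul_sum]
        split_ifs <;> simp
    _ = 0 := by
        rw [Finset.sum_comm]
        exact Finset.sum_eq_zero fun z _ => classJump z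

/-! ### Counting tiles sector by sector -/

open Classical in
/-- The indicator function of `sector k b`. -/
noncomputable def sectorInd (k : Fin 8) (b : Fin 8 → ℝ) (x : Plane) : ℤ :=
  if x ∈ sector k b then 1 else 0

/-- Pushing `x` a little into the sector replaces sector membership by membership in interiors,
which are disjoint; this gives uniqueness. For existence, finitely many tiles cover the pushed
points, so one of them is hit for arbitrarily small pushes. -/
theorem sum_sectorInd {ι : Type*} {I : Finset ι} {b : ι → Fin 8 → ℝ} {B : Fin 8 → ℝ}
    (hcov : poly B = ⋃ i ∈ I, poly (b i))
    (hdis : (I : Set ι).Pairwise fun i j => Disjoint (inner (b i)) (inner (b j)))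
    (k : Fin 8) (x : Plane) : ∑ i ∈ I, sectorInd k (b i) x = sectorInd k B x := by
  classical
  have huniq : ∀ i ∈ I, ∀ j ∈ I, x ∈ sector k (b i) → x ∈ sector k (b j) → i = j := by
    intro i hi j hj hxi hxj
    by_contra hij
    obtain ⟨ε, h1, h2⟩ := ((eventually_mem_inner hxi).and (eventually_mem_inner hxj)).exists
    exact Set.disjoint_left.1 (hdis hi hj hij) h1 h2
  by_cases hx : x ∈ sector k B
  · have hev := eventually_mem_inner hx
    obtain ⟨i, hi, hxi⟩ : ∃ i ∈ I, x ∈ sector k (b i) := by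
      by_contra! hno
      have hno' : ∀ᶠ ε : ℝ in 𝓝[>] 0, ∀ i ∈ I, x + ε • (dir k + dir (k + 1)) ∉ poly (b i) := by
        rw [Filter.eventually_all_finset]
        intro i hi
        by_contra hfr
        exact hno i hi (mem_sector_of_frequently hfr)
      obtain ⟨ε, h1, h2⟩ := (hev.and hno').exists
      have h3 := inner_subset_poly B h1
      rw [hcov] at h3
      obtain ⟨i, hi, h4⟩ := Set.mem_iUnion₂.1 h3
      exact h2 i hi h4
    rw [Finset.sum_eq_single_of_mem i hi]
    · simp [sectorInd, hx, hxi]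
    · intro j hj hji
      simp only [sectorInd, ite_eq_right_iff, one_ne_zero, imp_false]
      exact fun hxj => hji (huniq j hj i hi hxj hxi)
  · simp only [sectorInd, hx, if_false]
    refine Finset.sum_eq_zero fun i hi => if_neg fun hxi => hx ?_
    refine mem_sector_of_frequently (Eventually.frequently ?_)
    filter_upwards [eventually_mem_inner hxi] with ε hε
    rw [hcov]
    exact Set.mem_iUnion₂.2 ⟨i, hi, inner_subset_poly _ hε⟩

theorem ell_vert (b : Fin 8 → ℝ) (i : Fin 8) : ell i (vert b i) = b i := by
  induction i using fin_eight_cases <;> simp [ell, dir, vert]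

theorem ell_vert_sub_one (b : Fin 8 → ℝ) (i : Fin 8) : ell i (vert b (i - 1)) = b i := by
  induction i using fin_eight_cases <;> simp [ell, dir, vert]

theorem eq_coord_smul_dir {k : Fin 8} {v : Plane} (h : ell (k + 2) v = 0) :
    v = coord k v • dir k := by
  induction k using fin_eight_cases <;> simp [ell, dir, coord] at h ⊢ <;> ext <;> simp <;> linarith

theorem coord_add (k : Fin 8) (p q : Plane) : coord k (p + q) = coord k p + coord k q := by
  simp only [coord, ell_add]; ring

theorem coord_sub (k : Fin 8) (p q : Plane) : coord k (p - q) = coord k p - coord k q := by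
  simp only [coord, ell_sub]; ring

theorem coord_smul (k : Fin 8) (t : ℝ) (p : Plane) : coord k (t • p) = t * coord k p := by
  simp only [coord, ell_smul]; ring

theorem coord_dir (k : Fin 8) : coord k (dir k) = 1 := by
  induction k using fin_eight_cases <;> simp [coord, ell, dir] <;> norm_num

theorem coord_dir_opposite (k : Fin 8) : coord k (dir (k + 4)) = -1 := by
  induction k using fin_eight_cases <;> simp [coord, ell, dir] <;> norm_num

theorem coord_vert_right (b : Fin 8 → ℝ) (k : Fin 8) :
    coord k (vert b (k - 2)) = coord k (vert b (k - 3)) + sideLen b (k - 2) := by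
  have h := vert_eq_add b (k - 2)
  rw [show k - 2 - 1 = k - 3 by rw [sub_sub]; rfl, sub_add_cancel] at h
  rw [h, coord_add, coord_smul, coord_dir, mul_one]

theorem coord_vert_left (b : Fin 8 → ℝ) (k : Fin 8) :
    coord k (vert b (k + 1)) = coord k (vert b (k + 2)) + sideLen b (k + 2) := by
  have h := vert_eq_add b (k + 2)
  rw [show k + 2 - 1 = k + 1 by rw [add_sub_assoc]; rfl,
    show k + 2 + 2 = k + 4 by rw [add_assoc]; rfl] at h
  rw [h, coord_add, coord_smul, coord_dir_opposite]; ring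

/-- The difference of the indicators of two consecutive sectors is supported on the two sides
parallel to the ray that separates the sectors. -/
theorem sectorInd_sub {b : Fin 8 → ℝ} (h : ∀ i, 0 ≤ sideLen b i) (hne : (inner b).Nonempty)
    (k : Fin 8) (x : Plane) : sectorInd k b x - sectorInd (k - 1) b x =
      (if ell (k - 2) x = b (k - 2) then 1 else 0) *
        (if coord k (vert b (k - 3)) ≤ coord k x ∧ coord k x < coord k (vert b (k - 2))
          then 1 else 0) +
      (if ell (k + 2) x = b (k + 2) then -1 else 0) *
        (if coord k (vert b (k + 2)) ≤ coord k x ∧ coord k x < coord k (vert b (k + 1))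
          then 1 else 0) := by
  classical
  obtain ⟨z, hz⟩ := hne
  have z1 := hz (k - 2)
  have z2 := hz (k + 2)
  rw [ell_opposite] at z1
  have hopp := ell_opposite k x
  simp only [sectorInd, mem_sector_sub_one_iff]
  simp only [mem_sector_iff]
  by_cases h1 : ell (k - 2) x = b (k - 2)
  · have h2 : ell (k + 2) x ≠ b (k + 2) := by intro h2; linarith
    have h3 : ell (k + 2) x < b (k + 2) := by linarith
    simp only [← straddles_iff_right h h1, h1, h2, h3, h3.le]
    simp
  · by_cases h2 : ell (k + 2) x = b (k + 2)
    · have h3 : ell (k - 2) x < b (k - 2) := by linarith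
      simp only [← straddles_iff_left h h2, h1, h2, h3, h3.le]
      split_ifs <;> simp_all
    · have e1 : ell (k - 2) x ≤ b (k - 2) ↔ ell (k - 2) x < b (k - 2) :=
        ⟨fun h => lt_of_le_of_ne h h1, le_of_lt⟩
      have e2 : ell (k + 2) x ≤ b (k + 2) ↔ ell (k + 2) x < b (k + 2) :=
        ⟨fun h => lt_of_le_of_ne h h2, le_of_lt⟩
      simp [h1, h2, e1, e2]

theorem add_coord_smul_dir {k : Fin 8} {x v : Plane} (h : ell (k + 2) v = ell (k + 2) x) :
    x + (coord k v - coord k x) • dir k = v := by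
  rw [← coord_sub, ← eq_coord_smul_dir (by rw [ell_sub, h, sub_self]), add_sub_cancel]

/-! ### Tilings with classes -/

/-- Octagonal regions `poly (b i)` tiling `poly B`, together with classes `cls i` such that every
side in the interior of `poly B` has endpoints of the class of its tile. -/
structure ClassedTiling {ι C : Type*} (I : Finset ι) (b : ι → Fin 8 → ℝ) (B : Fin 8 → ℝ)
    (mk : Plane → C) (cls : ι → C) : Prop where
  cover : poly B = ⋃ i ∈ I, poly (b i)
  disjoint : (I : Set ι).Pairwise fun i j => Disjoint (inner (b i)) (inner (b j))
  sideLen_nonneg : ∀ i ∈ I, ∀ j, 0 ≤ sideLen (b i) j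
  inner_nonempty : ∀ i ∈ I, (inner (b i)).Nonempty
  sideLen_nonneg' : ∀ j, 0 ≤ sideLen B j
  side : ∀ i ∈ I, ∀ j, sideLen (b i) j = 0 ∨
    (mk (vert (b i) (j - 1)) = cls i ∧ mk (vert (b i) j) = cls i) ∨
    ∀ x ∈ inner B, ell j x ≠ b i j

namespace ClassedTiling

variable {ι C : Type*} {I : Finset ι} {b : ι → Fin 8 → ℝ} {B : Fin 8 → ℝ} {mk : Plane → C}
  {cls : ι → C}

/-- Each bound of the tile is attained at one of its vertices, which lies in `poly B`, so it is at
most the corresponding bound of `B`. -/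
theorem inner_subset (h : ClassedTiling I b B mk cls) {i : ι} (hi : i ∈ I) :
    inner (b i) ⊆ inner B := by
  intro x hx j
  have hv := vert_mem_poly (h.sideLen_nonneg i hi) j
  have hv' : vert (b i) j ∈ poly B := by
    rw [h.cover]; exact Set.mem_iUnion₂.2 ⟨i, hi, hv⟩
  have := hv' j
  rw [ell_vert] at this
  exact (hx j).trans_le this

theorem sum_class_sub_one [DecidableEq C] (h : ClassedTiling I b B mk cls) (c : C) (k : Fin 8)
    {x : Plane} (hx : x ∈ inner B) :
    ∑ i ∈ I, (if cls i = c then sectorInd k (b i) x else 0) =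
      ∑ i ∈ I, (if cls i = c then sectorInd (k - 1) (b i) x else 0) := by
  classical
  rw [← sub_eq_zero, ← Finset.sum_sub_distrib]
  have hline : ∀ t : ℝ, coord k (x + (t - coord k x) • dir k) = t ∧
      ell (k + 2) (x + (t - coord k x) • dir k) = ell (k + 2) x ∧
      ell (k - 2) (x + (t - coord k x) • dir k) = ell (k - 2) x := by
    intro t
    simp only [coord_add, coord_smul, coord_dir, ell_add, ell_smul, ell_opposite, ell_perp]
    refine ⟨by ring, by ring, by ring⟩
  -- As `x` is interior, its line along `dir k` contains neither side of `B` parallel to `dir k`, so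
  -- the total count does not change anywhere on this line.
  have hzero : ∀ t : ℝ, ∑ i ∈ I, (sectorInd k (b i) (x + (t - coord k x) • dir k) -
      sectorInd (k - 1) (b i) (x + (t - coord k x) • dir k)) = 0 := by
    intro t
    rw [Finset.sum_sub_distrib, sum_sectorInd h.cover h.disjoint, sum_sectorInd h.cover h.disjoint,
      sectorInd_sub h.sideLen_nonneg' ⟨x, hx⟩, (hline t).2.1, (hline t).2.2,
      if_neg (hx (k - 2)).ne, if_neg (hx (k + 2)).ne]
    ring
  -- Each tile gives two intervals, from its sides `k - 2` (`true`) and `k + 2` (`false`), with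
  -- coefficient zero unless the side lies on the line. The class of a real `t` is that of the point
  -- of the line with coordinate `t`.
  have key := sum_intervals_class_eq_zero (I ×ˢ (Finset.univ : Finset Bool))
    (fun e => if e.2 then (if ell (k - 2) x = b e.1 (k - 2) then 1 else 0)
      else (if ell (k + 2) x = b e.1 (k + 2) then -1 else 0))
    (fun e => if e.2 then coord k (vert (b e.1) (k - 3)) else coord k (vert (b e.1) (k + 2)))
    (fun e => if e.2 then coord k (vert (b e.1) (k - 2)) else coord k (vert (b e.1) (k + 1)))
    (fun e => cls e.1) (fun t => mk (x + (t - coord k x) • dir k)) ?_ ?_ ?_ c (coord k x)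
  · rw [Finset.sum_product] at key
    simp only [Fintype.sum_bool, if_true, Bool.false_eq_true, if_false] at key
    refine Eq.trans (Finset.sum_congr rfl fun i hi => ?_) key
    by_cases hc : cls i = c
    · simp only [if_pos hc]
      rw [sectorInd_sub (h.sideLen_nonneg i hi) (h.inner_nonempty i hi)]
    · simp only [if_neg hc, sub_self, add_zero]
  · rintro ⟨i, e⟩ hie
    have hi : i ∈ I := (Finset.mem_product.1 hie).1
    cases e
    · simp only [Bool.false_eq_true, if_false]
      have := coord_vert_left (b i) k
      linarith [h.sideLen_nonneg i hi (k + 2)]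
    · simp only [if_true]
      have := coord_vert_right (b i) k
      linarith [h.sideLen_nonneg i hi (k - 2)]
  · rintro ⟨i, e⟩ hie
    have hi : i ∈ I := (Finset.mem_product.1 hie).1
    cases e
    · simp only [Bool.false_eq_true, if_false]
      by_cases hon : ell (k + 2) x = b i (k + 2)
      · right
        rcases h.side i hi (k + 2) with h1 | ⟨h1, h2⟩ | h1
        · left; rw [coord_vert_left, h1, add_zero]
        · right
          have hv := ell_vert_sub_one (b i) (k + 2)
          rw [show k + 2 - 1 = k + 1 by rw [add_sub_assoc]; rfl] at h1 hv
          rw [add_coord_smul_dir (by rw [ell_vert, hon]), add_coord_smul_dir (by rw [hv, hon])]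
          exact ⟨h2, h1⟩
        · exact absurd hon (h1 x hx)
      · left; rw [if_neg hon]
    · simp only [if_true]
      by_cases hon : ell (k - 2) x = b i (k - 2)
      · right
        rcases h.side i hi (k - 2) with h1 | ⟨h1, h2⟩ | h1
        · left; rw [coord_vert_right, h1, add_zero]
        · right
          have hv := ell_vert_sub_one (b i) (k - 2)
          have hv' := ell_vert (b i) (k - 2)
          rw [show k - 2 - 1 = k - 3 by rw [sub_sub]; rfl] at h1 hv
          rw [← hon, ell_opposite, ell_opposite, neg_inj] at hv hv'
          rw [add_coord_smul_dir hv, add_coord_smul_dir hv']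
          exact ⟨h1, h2⟩
        · exact absurd hon (h1 x hx)
      · left; rw [if_neg hon]
  · intro t
    rw [Finset.sum_product]
    refine Eq.trans (Finset.sum_congr rfl fun i hi => ?_) (hzero t)
    rw [sectorInd_sub (h.sideLen_nonneg i hi) (h.inner_nonempty i hi), (hline t).1, (hline t).2.1,
      (hline t).2.2]
    simp

theorem sum_class_eq [DecidableEq C] (h : ClassedTiling I b B mk cls) (c : C) (k l : Fin 8)
    {x : Plane} (hx : x ∈ inner B) :
    ∑ i ∈ I, (if cls i = c then sectorInd k (b i) x else 0) =
      ∑ i ∈ I, (if cls i = c then sectorInd l (b i) x else 0) := by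
  have hs := fun k => h.sum_class_sub_one c k hx
  have h1 := hs 1
  have h2 := hs 2
  have h3 := hs 3
  have h4 := hs 4
  have h5 := hs 5
  have h6 := hs 6
  have h7 := hs 7
  simp only [Fin.reduceSub] at h1 h2 h3 h4 h5 h6 h7
  have h0 : ∀ k, ∑ i ∈ I, (if cls i = c then sectorInd k (b i) x else 0) =
      ∑ i ∈ I, (if cls i = c then sectorInd 0 (b i) x else 0) := by
    intro k
    induction k using fin_eight_cases <;> simp only [h1, h2, h3, h4, h5, h6, h7]
  rw [h0 k, h0 l]

/-- Tile `i` fills some sector at `x`, so its class has positive count in every sector, including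
one filled by tile `j`. Only one tile fills that sector, so `j` has this class. -/
theorem cls_eq_of_mem (h : ClassedTiling I b B mk cls) {i j : ι} (hi : i ∈ I) (hj : j ∈ I)
    {x : Plane} (hx : x ∈ inner B) (hxi : x ∈ poly (b i)) (hxj : x ∈ poly (b j)) :
    cls i = cls j := by
  classical
  by_contra hij
  obtain ⟨k, hk⟩ := exists_mem_sector hxi (h.inner_nonempty i hi).some_mem
  obtain ⟨l, hl⟩ := exists_mem_sector hxj (h.inner_nonempty j hj).some_mem
  have hpos : 0 < ∑ a ∈ I, (if cls a = cls i then sectorInd k (b a) x else 0) := by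
    refine Finset.sum_pos' (fun a _ => ?_) ⟨i, hi, ?_⟩
    · unfold sectorInd; split_ifs <;> simp
    · simp [sectorInd, hk]
  rw [h.sum_class_eq (cls i) k l hx] at hpos
  obtain ⟨a, ha, ha'⟩ := Finset.exists_ne_zero_of_sum_ne_zero hpos.ne'
  simp only [sectorInd, ne_eq, ite_eq_right_iff, one_ne_zero, imp_false, Classical.not_imp,
    not_not] at ha'
  obtain ⟨hac, hal⟩ := ha'
  obtain ⟨ε, h1, h2⟩ := ((eventually_mem_inner hal).and (eventually_mem_inner hl)).exists
  exact Set.disjoint_left.1 (h.disjoint ha hj fun e => hij (by rw [← hac, e])) h1 h2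

theorem convex_inner (B : Fin 8 → ℝ) : Convex ℝ (inner B) := by
  intro p hp q hq s t hs ht hst i
  rw [ell_add, ell_smul, ell_smul]
  have h1 := mul_le_mul_of_nonneg_left (hp i).le hs
  have h2 := mul_le_mul_of_nonneg_left (hq i).le ht
  rcases hs.eq_or_lt with rfl | hs
  · rw [zero_add] at hst; rw [hst, zero_mul, zero_add, one_mul]; exact hq i
  · have h1 := mul_lt_mul_of_pos_left (hp i) hs
    calc s * ell i p + t * ell i q < s * B i + t * B i := add_lt_add_of_lt_of_le h1 h2
      _ = B i := by rw [← add_mul, hst, one_mul]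

/-- All the tiles of a classed tiling have the same class. -/
theorem cls_eq (h : ClassedTiling I b B mk cls) {i j : ι} (hi : i ∈ I) (hj : j ∈ I) :
    cls i = cls j := by
  classical
  by_contra hij
  have hclosed : ∀ J : Finset ι, IsClosed (⋃ a ∈ J, poly (b a)) := fun J =>
    J.finite_toSet.isClosed_biUnion fun a _ => isClosed_poly (b a)
  -- The tiles of the class of `i` and the remaining ones form two closed sets that cover the
  -- connected interior. If both met it, they would share an interior point, against
  -- `cls_eq_of_mem`.
  have hpre := isPreconnected_closed_iff.1 (convex_inner B).isPreconnected
    _ _ (hclosed (I.filter (cls · = cls i))) (hclosed (I.filter (cls · ≠ cls i))) ?_ ?_ ?_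
  · obtain ⟨x, hx, h1, h2⟩ := hpre
    obtain ⟨a, ha, hxa⟩ := Set.mem_iUnion₂.1 h1
    obtain ⟨a', ha', hxa'⟩ := Set.mem_iUnion₂.1 h2
    rw [Finset.mem_filter] at ha ha'
    exact ha'.2 ((h.cls_eq_of_mem ha'.1 ha.1 hx hxa' hxa).trans ha.2)
  · intro x hx
    have hx' := inner_subset_poly B hx
    rw [h.cover] at hx'
    obtain ⟨a, ha, hxa⟩ := Set.mem_iUnion₂.1 hx'
    by_cases hc : cls a = cls i
    · exact Or.inl (Set.mem_iUnion₂.2 ⟨a, Finset.mem_filter.2 ⟨ha, hc⟩, hxa⟩)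
    · exact Or.inr (Set.mem_iUnion₂.2 ⟨a, Finset.mem_filter.2 ⟨ha, hc⟩, hxa⟩)
  · obtain ⟨z, hz⟩ := h.inner_nonempty i hi
    exact ⟨z, h.inner_subset hi hz, Set.mem_iUnion₂.2
      ⟨i, Finset.mem_filter.2 ⟨hi, rfl⟩, inner_subset_poly _ hz⟩⟩
  · obtain ⟨z, hz⟩ := h.inner_nonempty j hj
    exact ⟨z, h.inner_subset hj hz, Set.mem_iUnion₂.2
      ⟨j, Finset.mem_filter.2 ⟨hj, Ne.symm hij⟩, inner_subset_poly _ hz⟩⟩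

end ClassedTiling

/-! ### Colours of integral points -/

theorem IsBlack.isIntegralPoint {p : Plane} (h : IsBlack p) : IsIntegralPoint p :=
  let ⟨x, y, h, _⟩ := h
  ⟨x, y, h⟩

theorem isBlack_zero : IsBlack 0 := ⟨0, 0, by simp [Prod.ext_iff], by simp⟩

theorem isBlack_of_eq {p : Plane} (s t : ℤ) (h : p = ((s : ℝ) + t, (s : ℝ) - t)) : IsBlack p :=
  ⟨s + t, s - t, by rw [h]; push_cast; rfl, ⟨s, by ring⟩⟩

/-- The subgroup of black points. -/
def blackLattice : AddSubgroup Plane where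
  carrier := {p | IsBlack p}
  zero_mem' := isBlack_zero
  add_mem' := by
    rintro _ _ ⟨x, y, rfl, h⟩ ⟨x', y', rfl, h'⟩
    refine ⟨x + x', y + y', by push_cast; rfl, ?_⟩
    rw [show x + x' + (y + y') = x + y + (x' + y') by ring]
    exact h.add h'
  neg_mem' := by
    rintro _ ⟨x, y, rfl, h⟩
    refine ⟨-x, -y, by push_cast; rfl, ?_⟩
    rw [← neg_add]
    exact h.neg

theorem mem_blackLattice {p : Plane} : p ∈ blackLattice ↔ IsBlack p := Iff.rfl

theorem IsBlack.add {p q : Plane} (hp : IsBlack p) (hq : IsBlack q) : IsBlack (p + q) :=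
  blackLattice.add_mem hp hq

theorem IsBlack.add_isWhite {p q : Plane} (hp : IsBlack p) (hq : IsWhite q) : IsWhite (p + q) := by
  obtain ⟨x, y, rfl, h⟩ := hp
  obtain ⟨x', y', rfl, h'⟩ := hq
  refine ⟨x + x', y + y', by push_cast; rfl, ?_⟩
  rw [show x + x' + (y + y') = x + y + (x' + y') by ring]
  exact h.add_odd h'

theorem IsIntegralPoint.add {p q : Plane} (hp : IsIntegralPoint p) (hq : IsIntegralPoint q) :
    IsIntegralPoint (p + q) := by
  obtain ⟨x, y, rfl⟩ := hp
  obtain ⟨x', y', rfl⟩ := hq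
  exact ⟨x + x', y + y', by push_cast; rfl⟩

theorem IsIntegralPoint.neg {p : Plane} (hp : IsIntegralPoint p) : IsIntegralPoint (-p) := by
  obtain ⟨x, y, rfl⟩ := hp
  exact ⟨-x, -y, by push_cast; rfl⟩

theorem IsIntegralPoint.isBlack_or_isWhite {p : Plane} (hp : IsIntegralPoint p) :
    IsBlack p ∨ IsWhite p := by
  obtain ⟨x, y, rfl⟩ := hp
  exact (Int.even_or_odd (x + y)).imp (fun h => ⟨x, y, rfl, h⟩) fun h => ⟨x, y, rfl, h⟩

theorem IsBlack.not_isWhite {p : Plane} (hp : IsBlack p) : ¬ IsWhite p := by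
  rintro ⟨x', y', h, h'⟩
  obtain ⟨x, y, rfl, h''⟩ := hp
  simp only [Prod.mk.injEq, Int.cast_inj] at h
  rw [← h.1, ← h.2, ← Int.not_even_iff_odd] at h'
  exact h' h''

/-! ### Quarter turns and translations -/

@[elab_as_elim]
theorem fin_four_cases {P : Fin 4 → Prop} (h0 : P 0) (h1 : P 1) (h2 : P 2) (h3 : P 3) (i : Fin 4) :
    P i := by
  fin_cases i <;> assumption

theorem place_zero (v p : Plane) : place 0 v p = v + p := rfl

theorem place_one (v p : Plane) : place 1 v p = v + (-p.2, p.1) := rfl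

theorem place_two (v p : Plane) : place 2 v p = v + (-p.1, -p.2) := rfl

theorem place_three (v p : Plane) : place 3 v p = v + (p.2, -p.1) := by
  simp [place, quarterTurn]

theorem place_origin (k : Fin 4) (v : Plane) : place k v (0, 0) = v := by
  induction k using fin_four_cases <;> simp [place_zero, place_one, place_two, place_three]

theorem IsIntegralPoint.place_sub {p q : Plane} (h : IsIntegralPoint (p - q)) (k : Fin 4)
    (v : Plane) : IsIntegralPoint (place k v p - place k v q) := by
  obtain ⟨x, y, h⟩ := h
  obtain ⟨p1, p2⟩ := p
  obtain ⟨q1, q2⟩ := q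
  simp only [Prod.mk_sub_mk, Prod.mk.injEq] at h
  obtain ⟨h1, h2⟩ := h
  induction k using fin_four_cases
  · exact ⟨x, y, by ext <;> simp [place_zero] <;> linarith⟩
  · exact ⟨-y, x, by ext <;> simp [place_one] <;> linarith⟩
  · exact ⟨-x, -y, by ext <;> simp [place_two] <;> linarith⟩
  · exact ⟨y, -x, by ext <;> simp [place_three] <;> linarith⟩

theorem IsBlack.place_sub {p q : Plane} (h : IsBlack (p - q)) (k : Fin 4) (v : Plane) :
    IsBlack (place k v p - place k v q) := by
  obtain ⟨x, y, h, c, hc⟩ := h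
  obtain ⟨p1, p2⟩ := p
  obtain ⟨q1, q2⟩ := q
  simp only [Prod.mk_sub_mk, Prod.mk.injEq] at h
  obtain ⟨h1, h2⟩ := h
  induction k using fin_four_cases
  · exact ⟨x, y, by ext <;> simp [place_zero] <;> linarith, c, hc⟩
  -- From `x + y = 2c` one gets `x - y = 2(x - c)`; the last case is symmetric.
  · exact ⟨-y, x, by ext <;> simp [place_one] <;> linarith, x - c, by linarith⟩
  · exact ⟨-x, -y, by ext <;> simp [place_two] <;> linarith, -c, by linarith⟩
  · exact ⟨y, -x, by ext <;> simp [place_three] <;> linarith, y - c, by linarith⟩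

/-! ### The shapes as octagonal regions -/

/-- The bounds that describe a shape in standard position as an octagonal region. -/
def Shape.bound : Shape → Fin 8 → ℝ
  | .square => ![2, 4, 2, 2, 0, 0, 0, 2]
  | .diamond => ![2, 3, 2, 1, 0, -1, 0, 1]
  | .triangle a => ![a, a, a, a, 0, 0, 0, a]
  | .trapezoid a => ![2 * a + 2, 2 * a + 2, a, 0, 0, 0, 0, 2 * a + 2]
  | .hexagon a => ![a + 2, 2 * a + 4, a + 2, 2, 0, 0, 0, 2]
  | .octagon a b => ![a + b + 2, 2 * a + b + 4, a + b + 2, b + 2, 0, -b, 0, b + 2]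

/-- A vertex of a shape in standard position that is not a right-angle vertex of a triangle. -/
def Shape.base : Shape → Plane
  | .square => (0, 0)
  | .diamond => (1, 0)
  | .triangle a => (a, 0)
  | .trapezoid _ => (0, 0)
  | .hexagon _ => (0, 0)
  | .octagon _ b => (b, 0)

theorem one_le_pnat (a : ℕ+) : (1 : ℝ) ≤ (a : ℝ) := by exact_mod_cast (one_le : 1 ≤ a)

theorem forall_fin_eight {P : Fin 8 → Prop} :
    (∀ i, P i) ↔ P 0 ∧ P 1 ∧ P 2 ∧ P 3 ∧ P 4 ∧ P 5 ∧ P 6 ∧ P 7 :=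
  ⟨fun h => ⟨h _, h _, h _, h _, h _, h _, h _, h _⟩, fun ⟨h0, h1, h2, h3, h4, h5, h6, h7⟩ i => by
    induction i using fin_eight_cases <;> assumption⟩

theorem exists_fin_eight {P : Fin 8 → Prop} :
    (∃ i, P i) ↔ P 0 ∨ P 1 ∨ P 2 ∨ P 3 ∨ P 4 ∨ P 5 ∨ P 6 ∨ P 7 := by
  rw [← not_iff_not]
  push Not
  exact forall_fin_eight

/-- In these vertex tables, a corner is repeated for each side of length zero that sits at it. -/
theorem Shape.vert_square : vert Shape.square.bound =
    ![(2, 2), (2, 2), (0, 2), (0, 2), (0, 0), (0, 0), (2, 0), (2, 0)] := by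
  ext i <;> induction i using fin_eight_cases <;> simp [vert, Shape.bound] <;> ring

theorem Shape.vert_diamond : vert Shape.diamond.bound =
    ![(2, 1), (1, 2), (1, 2), (0, 1), (0, 1), (1, 0), (1, 0), (2, 1)] := by
  ext i <;> induction i using fin_eight_cases <;> simp [vert, Shape.bound] <;> norm_num

theorem Shape.vert_triangle (a : ℕ+) : vert (Shape.triangle a).bound =
    ![((a : ℝ), 0), (0, (a : ℝ)), (0, (a : ℝ)), (0, (a : ℝ)), (0, 0), (0, 0), ((a : ℝ), 0),
      ((a : ℝ), 0)] := by
  ext i <;> induction i using fin_eight_cases <;> simp [vert, Shape.bound]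

theorem Shape.vert_trapezoid (a : ℕ+) : vert (Shape.trapezoid a).bound =
    ![(2 * (a : ℝ) + 2, 0), ((a : ℝ) + 2, (a : ℝ)), ((a : ℝ), (a : ℝ)), (0, 0), (0, 0), (0, 0),
      (2 * (a : ℝ) + 2, 0), (2 * (a : ℝ) + 2, 0)] := by
  ext i <;> induction i using fin_eight_cases <;> simp [vert, Shape.bound] <;> ring

theorem Shape.vert_hexagon (a : ℕ+) : vert (Shape.hexagon a).bound =
    ![((a : ℝ) + 2, (a : ℝ) + 2), ((a : ℝ) + 2, (a : ℝ) + 2), ((a : ℝ), (a : ℝ) + 2), (0, 2),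
      (0, 0), (0, 0), (2, 0), ((a : ℝ) + 2, (a : ℝ))] := by
  ext i <;> induction i using fin_eight_cases <;> simp [vert, Shape.bound] <;> ring

theorem Shape.vert_octagon (a b : ℕ+) : vert (Shape.octagon a b).bound =
    ![((a : ℝ) + b + 2, (a : ℝ) + 2), ((a : ℝ) + 2, (a : ℝ) + b + 2), ((a : ℝ), (a : ℝ) + b + 2),
      (0, (b : ℝ) + 2), (0, (b : ℝ)), ((b : ℝ), 0), ((b : ℝ) + 2, 0),
      ((a : ℝ) + b + 2, (a : ℝ))] := by
  ext i <;> induction i using fin_eight_cases <;> simp [vert, Shape.bound] <;> ring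

theorem Shape.mem_corners_iff (s : Shape) (p : Plane) :
    p ∈ s.corners ↔ ∃ i, vert s.bound i = p := by
  rw [exists_fin_eight]
  cases s with
  | square => rw [vert_square]; simp [Shape.corners]; grind
  | diamond => rw [vert_diamond]; simp [Shape.corners]; grind
  | triangle a => rw [vert_triangle]; simp [Shape.corners]; grind
  | trapezoid a => rw [vert_trapezoid]; simp [Shape.corners]; grind
  | hexagon a => rw [vert_hexagon]; simp [Shape.corners]; grind
  | octagon a b => rw [vert_octagon]; simp [Shape.corners]; grind

theorem Shape.sideLen_nonneg (s : Shape) (i : Fin 8) : 0 ≤ sideLen s.bound i := by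
  cases s with
  | square => induction i using fin_eight_cases <;> simp [sideLen, Shape.bound] <;> norm_num
  | diamond => induction i using fin_eight_cases <;> simp [sideLen, Shape.bound] <;> norm_num
  | triangle a =>
    have := one_le_pnat a
    induction i using fin_eight_cases <;> simp [sideLen, Shape.bound] <;> linarith
  | trapezoid a =>
    have := one_le_pnat a
    induction i using fin_eight_cases <;> simp [sideLen, Shape.bound] <;> linarith
  | hexagon a =>
    have := one_le_pnat a
    induction i using fin_eight_cases <;> simp [sideLen, Shape.bound] <;> linarith
  | octagon a b =>
    have := one_le_pnat a
    have := one_le_pnat b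
    induction i using fin_eight_cases <;> simp [sideLen, Shape.bound] <;> linarith

/-- The margin `1 / 4` is the same for all shapes and parameters; it places a ball of fixed radius
in every tile, which bounds the number of tiles. -/
theorem Shape.exists_center (s : Shape) : ∃ z, ∀ i, ell i z + 1 / 4 ≤ s.bound i := by
  cases s with
  | square =>
    refine ⟨(1, 1), fun i => ?_⟩
    induction i using fin_eight_cases <;> simp [ell, dir, Shape.bound] <;> norm_num
  | diamond =>
    refine ⟨(1, 1), fun i => ?_⟩
    induction i using fin_eight_cases <;> simp [ell, dir, Shape.bound] <;> norm_num
  | triangle a =>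
    have := one_le_pnat a
    refine ⟨(1 / 4, 1 / 4), fun i => ?_⟩
    induction i using fin_eight_cases <;> simp [ell, dir, Shape.bound] <;> linarith
  | trapezoid a =>
    have := one_le_pnat a
    refine ⟨((a : ℝ) + 1, 1 / 2), fun i => ?_⟩
    induction i using fin_eight_cases <;> simp [ell, dir, Shape.bound] <;> linarith
  | hexagon a =>
    have := one_le_pnat a
    refine ⟨(1, 1), fun i => ?_⟩
    induction i using fin_eight_cases <;> simp [ell, dir, Shape.bound] <;> linarith
  | octagon a b =>
    have := one_le_pnat a
    have := one_le_pnat b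
    refine ⟨((a : ℝ) / 2 + b / 2 + 1, (a : ℝ) / 2 + b / 2 + 1), fun i => ?_⟩
    induction i using fin_eight_cases <;> simp [ell, dir, Shape.bound] <;> linarith

theorem isBlack_of_table {b : Fin 8 → ℝ} {w : Plane} (f : Fin 8 → ℤ × ℤ) (i : Fin 8)
    (h : vert b i - w = (((f i).1 : ℝ) + (f i).2, ((f i).1 : ℝ) - (f i).2)) :
    IsBlack (vert b i - w) :=
  isBlack_of_eq _ _ h

/-- Black vectors are those of the form `(s + t, s - t)` with `s`, `t` integers; the tables list the
pairs `(s, t)`. Indices `4` and `5` of a triangle are its right-angle vertex, whose colour relative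
to the base depends on the parity of `a`. -/
theorem Shape.isBlack_vert_sub_base (s : Shape) (i : Fin 8) :
    IsBlack (vert s.bound i - s.base) ∨ (∃ a, s = .triangle a) ∧ (i = 4 ∨ i = 5) := by
  cases s with
  | square =>
    left
    refine isBlack_of_table
      ![(2, 0), (2, 0), (1, -1), (1, -1), (0, 0), (0, 0), (1, 1), (1, 1)] i ?_
    rw [vert_square]
    ext <;> induction i using fin_eight_cases <;> simp [Shape.base] <;> ring
  | diamond =>
    left
    refine isBlack_of_table
      ![(1, 0), (1, -1), (1, -1), (0, -1), (0, -1), (0, 0), (0, 0), (1, 0)] i ?_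
    rw [vert_diamond]
    ext <;> induction i using fin_eight_cases <;> simp [Shape.base] <;> ring
  | triangle a =>
    by_cases hi : i = 4 ∨ i = 5
    · exact Or.inr ⟨⟨a, rfl⟩, hi⟩
    · left
      refine isBlack_of_table
        ![(0, 0), (0, -a), (0, -a), (0, -a), (0, 0), (0, 0), (0, 0), (0, 0)] i ?_
      rw [vert_triangle]
      ext <;> induction i using fin_eight_cases <;> simp [Shape.base] at hi ⊢
  | trapezoid a =>
    left
    refine isBlack_of_table ![(a + 1, a + 1), (a + 1, 1), (a, 0), (0, 0), (0, 0), (0, 0),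
      (a + 1, a + 1), (a + 1, a + 1)] i ?_
    rw [vert_trapezoid]
    ext <;> induction i using fin_eight_cases <;> simp [Shape.base] <;> ring
  | hexagon a =>
    left
    refine isBlack_of_table ![(a + 2, 0), (a + 2, 0), (a + 1, -1), (1, -1), (0, 0), (0, 0),
      (1, 1), (a + 1, 1)] i ?_
    rw [vert_hexagon]
    ext <;> induction i using fin_eight_cases <;> simp [Shape.base] <;> ring
  | octagon a b =>
    left
    refine isBlack_of_table ![(a + 2, 0), (a + 2, -b), (a + 1, -b - 1), (1, -b - 1), (0, -b),
      (0, 0), (1, 1), (a + 1, 1)] i ?_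
    rw [vert_octagon]
    ext <;> induction i using fin_eight_cases <;> simp [Shape.base] <;> ring

theorem Shape.isIntegralPoint_vert_sub_base (s : Shape) (i : Fin 8) :
    IsIntegralPoint (vert s.bound i - s.base) := by
  rcases s.isBlack_vert_sub_base i with h | ⟨⟨a, rfl⟩, rfl | rfl⟩
  · exact h.isIntegralPoint
  · exact ⟨-a, 0, by rw [vert_triangle]; simp [Shape.base]⟩
  · exact ⟨-a, 0, by rw [vert_triangle]; simp [Shape.base]⟩

/-- The number of sides by which `k` quarter turns shift the sides of an octagonal region. -/
def turnShift : Fin 4 → Fin 8 := ![0, 2, 4, 6]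

/-- The bounds of an octagonal region after `k` quarter turns and the translation by `v`. -/
def placeBound (k : Fin 4) (v : Plane) (b : Fin 8 → ℝ) (i : Fin 8) : ℝ :=
  b (i - turnShift k) + ell i v

theorem vert_placeBound (k : Fin 4) (v : Plane) (b : Fin 8 → ℝ) (i : Fin 8) :
    vert (placeBound k v b) i = place k v (vert b (i - turnShift k)) := by
  induction k using fin_four_cases <;> induction i using fin_eight_cases <;> ext <;>
    simp [vert, placeBound, turnShift, place_zero, place_one, place_two, place_three, ell, dir] <;>
    ring

theorem sideLen_placeBound (k : Fin 4) (v : Plane) (b : Fin 8 → ℝ) (i : Fin 8) :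
    sideLen (placeBound k v b) i = sideLen b (i - turnShift k) := by
  induction k using fin_four_cases <;> induction i using fin_eight_cases <;>
    simp [sideLen, placeBound, turnShift, ell, dir] <;> ring

theorem ell_place (k : Fin 4) (v p : Plane) (i : Fin 8) :
    ell i (place k v p) = ell (i - turnShift k) p + ell i v := by
  induction k using fin_four_cases <;> induction i using fin_eight_cases <;>
    simp [turnShift, place_zero, place_one, place_two, place_three, ell, dir] <;> ring

/-! ### The rectangle and its boundary -/

/-- The bounds of the rectangle `R`. -/
def rectBound (m n : ℕ) : Fin 8 → ℝ :=
  ![(m : ℝ) - 1, (m : ℝ) - 1 + (n - 1), (n : ℝ) - 1, (n : ℝ) - 1, 0, 0, 0, (m : ℝ) - 1]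

theorem poly_rectBound (m n : ℕ) : poly (rectBound m n) = rect m n := by
  ext ⟨x, y⟩
  simp only [poly, Set.mem_ofPred_eq, forall_fin_eight, rect, Set.mem_prod, Set.mem_Icc]
  simp [ell, dir, rectBound]
  constructor
  · rintro ⟨h0, h1, h2, h3, h4, h5, h6, h7⟩
    exact ⟨⟨h4, h0⟩, h6, h2⟩
  · rintro ⟨⟨h4, h0⟩, h6, h2⟩
    refine ⟨h0, ?_, h2, ?_, h4, ?_, h6, ?_⟩ <;> linarith

theorem sideLen_rectBound_nonneg {m n : ℕ} (hm : 2 ≤ m) (hn : 2 ≤ n) (i : Fin 8) :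
    0 ≤ sideLen (rectBound m n) i := by
  have hm' : (2 : ℝ) ≤ m := by exact_mod_cast hm
  have hn' : (2 : ℝ) ≤ n := by exact_mod_cast hn
  induction i using fin_eight_cases <;> simp [sideLen, rectBound] <;> linarith

theorem not_mem_frontier_of_mem_inner {b : Fin 8 → ℝ} {x : Plane} (hx : x ∈ inner b) :
    x ∉ frontier (poly b) := fun h =>
  h.2 (interior_maximal (inner_subset_poly b) (isOpen_inner b) hx)

/-- A side that runs along the frontier of a larger octagonal region does not meet its interior,
nor does the line supporting it. -/
theorem ell_ne_of_segment_subset_frontier {b B : Fin 8 → ℝ} {j : Fin 8}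
    (h0 : vert b (j - 1) ∈ poly B) (h1 : vert b j ∈ poly B) (hlen : sideLen b j ≠ 0)
    (hseg : segment ℝ (vert b (j - 1)) (vert b j) ⊆ frontier (poly B)) {x : Plane}
    (hx : x ∈ inner B) : ell j x ≠ b j := by
  intro hj
  have hmid : ∀ i, ell i (midpoint ℝ (vert b (j - 1)) (vert b j)) =
      ell i (vert b (j - 1)) + sideLen b j * ell i (dir (j + 2)) / 2 := by
    intro i
    rw [midpoint_eq_smul_add, vert_eq_add b j]
    simp only [ell_add, ell_smul, invOf_eq_inv]
    ring
  -- If the line of the side met the interior at `x`, the midpoint of the side would be interior. A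
  -- functional constant along the side takes its value at `x`; any other differs at the two
  -- endpoints, so its value at the midpoint is strictly below the larger one.
  refine not_mem_frontier_of_mem_inner (b := B) (fun i => ?_)
    (hseg (midpoint_mem_segment (𝕜 := ℝ) (vert b (j - 1)) (vert b j)))
  by_cases hi : ell i (dir (j + 2)) = 0
  · have hpar : ell (j + 2 + 2) (midpoint ℝ (vert b (j - 1)) (vert b j) - x) = 0 := by
      have hopp := ell_opposite (j + 2) (midpoint ℝ (vert b (j - 1)) (vert b j) - x)
      have hd := ell_opposite (j + 2) (dir (j + 2))
      rw [ell_perp, add_sub_cancel_right] at hd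
      rw [add_sub_cancel_right, ell_sub, hmid, ell_vert_sub_one, hj, hd] at hopp
      linarith
    have h := congrArg (ell i) (eq_coord_smul_dir hpar)
    rw [ell_smul, hi, mul_zero, ell_sub, sub_eq_zero] at h
    rw [h]
    exact hx i
  · have h2 := h0 i
    have h3 := h1 i
    rw [vert_eq_add b j, ell_add, ell_smul] at h3
    rw [hmid]
    rcases (mul_ne_zero hlen hi).lt_or_gt with h | h <;> linarith

theorem frontier_rect_cases {m n : ℕ} {p : Plane} (hp : p ∈ frontier (rect m n)) :
    p ∈ rect m n ∧ (p.1 = 0 ∨ p.1 = (m : ℝ) - 1 ∨ p.2 = 0 ∨ p.2 = (n : ℝ) - 1) := by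
  have hcl : IsClosed (rect m n) := by rw [← poly_rectBound]; exact isClosed_poly _
  have hmem : p ∈ rect m n := hcl.frontier_subset hp
  refine ⟨hmem, ?_⟩
  by_contra! hne
  obtain ⟨h1, h2, h3, h4⟩ := hne
  rw [← poly_rectBound] at hp
  refine not_mem_frontier_of_mem_inner ?_ hp
  simp only [rect, Set.mem_prod, Set.mem_Icc] at hmem
  obtain ⟨⟨g1, g2⟩, g3, g4⟩ := hmem
  have g1 := lt_of_le_of_ne g1 h1.symm
  have g2 := lt_of_le_of_ne g2 h2
  have g3 := lt_of_le_of_ne g3 h3.symm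
  have g4 := lt_of_le_of_ne g4 h4
  intro i
  induction i using fin_eight_cases <;> simp [ell, dir, rectBound] <;> linarith

/-- The midpoint of the segment has its first coordinate strictly between those of two points of
`R`, so it can only be on a horizontal side of `R`. -/
theorem eq_of_horizontal_subset_frontier {m n : ℕ} {p q : Plane} (h2 : p.2 = q.2) (h1 : p.1 ≠ q.1)
    (h : segment ℝ p q ⊆ frontier (rect m n)) : p.2 ∈ ({0, (n : ℝ) - 1} : Set ℝ) := by
  have hp := (frontier_rect_cases (h (left_mem_segment ℝ p q))).1
  have hq := (frontier_rect_cases (h (right_mem_segment ℝ p q))).1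
  have hm := (frontier_rect_cases (h (midpoint_mem_segment (𝕜 := ℝ) p q))).2
  rw [midpoint_eq_smul_add] at hm
  simp [← h2] at hm
  simp only [rect, Set.mem_prod, Set.mem_Icc] at hp hq
  obtain ⟨⟨a1, a2⟩, a3, a4⟩ := hp
  obtain ⟨⟨b1, b2⟩, b3, b4⟩ := hq
  rw [Set.mem_insert_iff, Set.mem_singleton_iff]
  by_contra! hne
  rcases h1.lt_or_gt with h1 | h1 <;> rcases hm with hm | hm | hm | hm <;>
    first
    | linarith
    | exact hne.1 (by linarith)
    | exact hne.2 (by linarith)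

theorem eq_of_vertical_subset_frontier {m n : ℕ} {p q : Plane} (h1 : p.1 = q.1) (h2 : p.2 ≠ q.2)
    (h : segment ℝ p q ⊆ frontier (rect m n)) : p.1 ∈ ({0, (m : ℝ) - 1} : Set ℝ) := by
  have hp := (frontier_rect_cases (h (left_mem_segment ℝ p q))).1
  have hq := (frontier_rect_cases (h (right_mem_segment ℝ p q))).1
  have hm := (frontier_rect_cases (h (midpoint_mem_segment (𝕜 := ℝ) p q))).2
  rw [midpoint_eq_smul_add] at hm
  simp [← h1] at hm
  simp only [rect, Set.mem_prod, Set.mem_Icc] at hp hq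
  obtain ⟨⟨a1, a2⟩, a3, a4⟩ := hp
  obtain ⟨⟨b1, b2⟩, b3, b4⟩ := hq
  rw [Set.mem_insert_iff, Set.mem_singleton_iff]
  by_contra! hne
  rcases h2.lt_or_gt with h2 | h2 <;> rcases hm with hm | hm | hm | hm <;>
    first
    | linarith
    | exact hne.1 (by linarith)
    | exact hne.2 (by linarith)

theorem right_angle_mem_rectCorners {m n : ℕ} {a : ℕ+} {k : Fin 4} {v : Plane}
    (h : ∀ e ∈ (Shape.triangle a).dashed,
      segment ℝ (place k v e.1) (place k v e.2) ⊆ frontier (rect m n)) :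
    v ∈ rectCorners m n := by
  have e1 := h ((0, 0), ((a : ℝ), 0)) (by simp [Shape.dashed])
  have e2 := h ((0, 0), (0, (a : ℝ))) (by simp [Shape.dashed])
  rw [place_origin] at e1 e2
  simp only at e1 e2
  rw [rectCorners, Set.mem_prod]
  induction k using fin_four_cases
  · exact ⟨eq_of_vertical_subset_frontier (by simp [place_zero]) (by simp [place_zero]) e2,
      eq_of_horizontal_subset_frontier (by simp [place_zero]) (by simp [place_zero]) e1⟩
  · exact ⟨eq_of_vertical_subset_frontier (by simp [place_one]) (by simp [place_one]) e1,
      eq_of_horizontal_subset_frontier (by simp [place_one]) (by simp [place_one]) e2⟩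
  · exact ⟨eq_of_vertical_subset_frontier (by simp [place_two]) (by simp [place_two]) e2,
      eq_of_horizontal_subset_frontier (by simp [place_two]) (by simp [place_two]) e1⟩
  · exact ⟨eq_of_vertical_subset_frontier (by simp [place_three]) (by simp [place_three]) e1,
      eq_of_horizontal_subset_frontier (by simp [place_three]) (by simp [place_three]) e2⟩

/-! ### Admissible tiles as octagonal regions -/

/-- `V` is the vertex set of the octagonal region with bounds `b`, which is a tile admissible in
`R` having `w` as a vertex other than a right-angle vertex of a triangle. -/
structure TileData (m n : ℕ) (V : Set Plane) (b : Fin 8 → ℝ) (w : Plane) : Prop where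
  vertices : V = Set.range (vert b)
  sideLen_nonneg : ∀ i, 0 ≤ sideLen b i
  exists_center : ∃ z, ∀ i, ell i z + 1 / 4 ≤ b i
  integral : ∀ p ∈ V, IsIntegralPoint (p - w)
  color : ∀ p ∈ V, IsBlack (p - w) ∨ IsRightAngleVertex V p ∧ p ∈ rectCorners m n
  side : ∀ i, sideLen b i = 0 ∨ (IsBlack (vert b (i - 1) - w) ∧ IsBlack (vert b i - w)) ∨
    segment ℝ (vert b (i - 1)) (vert b i) ⊆ frontier (rect m n)

theorem IsTile.exists_tileData {m n : ℕ} {V : Set Plane} (h : IsTile m n V) :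
    ∃ b w, TileData m n V b w := by
  obtain ⟨s, k, v, hV, hdash⟩ := h
  have hvert := vert_placeBound k v s.bound
  have hV' : V = Set.range (vert (placeBound k v s.bound)) := by
    rw [hV]
    ext q
    simp only [placedVertices, s.mem_corners_iff, Set.mem_ofPred_eq, Set.mem_range, hvert]
    constructor
    · rintro ⟨_, ⟨i, rfl⟩, rfl⟩
      exact ⟨i + turnShift k, by rw [add_sub_cancel_right]⟩
    · rintro ⟨i, rfl⟩
      exact ⟨_, ⟨_, rfl⟩, rfl⟩
  have hblack : ∀ i, IsBlack (vert (placeBound k v s.bound) i - place k v s.base) ∨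
      (∃ a, s = .triangle a) ∧ (i - turnShift k = 4 ∨ i - turnShift k = 5) := by
    intro i
    rw [hvert]
    exact (s.isBlack_vert_sub_base _).imp_left fun h => h.place_sub k v
  refine ⟨placeBound k v s.bound, place k v s.base, hV', fun i => ?_, ?_, ?_, ?_, fun i => ?_⟩
  · rw [sideLen_placeBound]; exact s.sideLen_nonneg _
  · obtain ⟨z, hz⟩ := s.exists_center
    refine ⟨place k v z, fun i => ?_⟩
    rw [ell_place, placeBound]
    linarith [hz (i - turnShift k)]
  · rw [hV']
    rintro _ ⟨i, rfl⟩
    rw [hvert]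
    exact (s.isIntegralPoint_vert_sub_base _).place_sub k v
  · intro p hp
    rw [hV'] at hp
    obtain ⟨i, rfl⟩ := hp
    refine (hblack i).imp_right ?_
    rintro ⟨⟨a, rfl⟩, hi⟩
    have hp : vert (placeBound k v (Shape.triangle a).bound) i = place k v (0, 0) := by
      rw [hvert]
      rcases hi with hi | hi <;> rw [hi, Shape.vert_triangle] <;> simp
    refine ⟨⟨a, k, v, hV, hp⟩, ?_⟩
    rw [hp, place_origin]
    exact right_angle_mem_rectCorners hdash
  -- If an endpoint is the right-angle vertex, the side is, before turning, number `4` or `6` (a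
  -- leg, on the boundary of `R`) or number `5` (of length zero).
  · rcases hblack (i - 1) with h1 | ⟨⟨a, rfl⟩, h1⟩
    · rcases hblack i with h2 | ⟨⟨a, rfl⟩, h2⟩
      · exact Or.inr (Or.inl ⟨h1, h2⟩)
      · rcases h2 with h2 | h2
        · right; right
          rw [hvert, hvert, sub_right_comm, h2, segment_symm, Shape.vert_triangle]
          exact hdash ((0, 0), (0, (a : ℝ))) (by simp [Shape.dashed])
        · left
          rw [sideLen_placeBound, h2]
          simp [sideLen, Shape.bound]
    · rw [sub_right_comm] at h1
      rcases h1 with h1 | h1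
      · left
        have h3 : i - turnShift k = 5 := eq_add_of_sub_eq h1
        rw [sideLen_placeBound, h3]
        simp [sideLen, Shape.bound]
      · right; right
        have h3 : i - turnShift k = 6 := eq_add_of_sub_eq h1
        rw [hvert, hvert, sub_right_comm, h1, h3, Shape.vert_triangle]
        exact hdash ((0, 0), ((a : ℝ), 0)) (by simp [Shape.dashed])

namespace TileData

variable {m n : ℕ} {V : Set Plane} {b : Fin 8 → ℝ} {w : Plane}

theorem convexHull_eq (h : TileData m n V b w) : convexHull ℝ V = poly b := by
  rw [h.vertices, convexHull_range_vert h.sideLen_nonneg]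

theorem inner_subset_interior (h : TileData m n V b w) : inner b ⊆ interior (convexHull ℝ V) := by
  rw [h.convexHull_eq]
  exact interior_maximal (inner_subset_poly b) (isOpen_inner b)

theorem inner_nonempty (h : TileData m n V b w) : (inner b).Nonempty := by
  obtain ⟨z, hz⟩ := h.exists_center
  exact ⟨z, fun i => by linarith [hz i]⟩

theorem exists_ball_subset (h : TileData m n V b w) : ∃ z, Metric.ball z (1 / 8) ⊆ inner b := by
  obtain ⟨z, hz⟩ := h.exists_center
  refine ⟨z, fun x hx i => lt_of_lt_of_le ?_ (hz i)⟩
  -- The distance is the maximum of the coordinate distances, so within radius `1 / 8` each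
  -- functional varies by less than `1 / 4`.
  rw [Metric.mem_ball, Prod.dist_eq, max_lt_iff, Real.dist_eq, Real.dist_eq, abs_lt, abs_lt] at hx
  obtain ⟨⟨h1, h2⟩, h3, h4⟩ := hx
  induction i using fin_eight_cases <;> simp [ell, dir] <;> linarith

end TileData

/-! ### Application to tilings of the rectangle -/

/-- The tiles contain pairwise disjoint balls of one fixed positive area, all inside the bounded set
`R`. -/
theorem IsTiling.finite {m n : ℕ} {T : Set (Set Plane)} (hT : IsTiling m n T) : T.Finite := by
  have hdata : ∀ V : T, ∃ z, Metric.ball z (1 / 8) ⊆ interior (convexHull ℝ (V : Set Plane)) := by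
    intro V
    obtain ⟨b, w, h⟩ := (hT.isTile V V.2).exists_tileData
    obtain ⟨z, hz⟩ := h.exists_ball_subset
    exact ⟨z, hz.trans h.inner_subset_interior⟩
  choose z hz using hdata
  have hfin := MeasureTheory.Measure.finite_const_le_meas_of_disjoint_iUnion
    (MeasureTheory.volume : MeasureTheory.Measure Plane)
    (ε := MeasureTheory.volume (Metric.ball (0 : Plane) (1 / 8)))
    (Metric.measure_ball_pos _ _ (by norm_num)) (As := fun V : T => Metric.ball (z V) (1 / 8))
    (fun V => measurableSet_ball) ?_ ?_
  · have huniv : {V : T | MeasureTheory.volume (Metric.ball (0 : Plane) (1 / 8)) ≤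
        MeasureTheory.volume (Metric.ball (z V) (1 / 8))} = Set.univ := by
      ext V
      simp [MeasureTheory.Measure.addHaar_ball_center]
    rw [huniv] at hfin
    exact Set.finite_coe_iff.1 (Set.finite_univ_iff.1 hfin)
  · intro V W hVW
    exact (hT.disjoint V.2 W.2 fun e => hVW (Subtype.ext e)).mono (hz V) (hz W)
  · have hsub : (⋃ V : T, Metric.ball (z V) (1 / 8)) ⊆ rect m n := by
      rw [← hT.cover]
      refine Set.iUnion_subset fun V => ?_
      exact ((hz V).trans interior_subset).trans
        (Set.subset_biUnion_of_mem (u := fun V => convexHull ℝ V) V.2)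
    exact ((MeasureTheory.measure_mono hsub).trans_lt
      (isCompact_Icc.prod isCompact_Icc).measure_lt_top).ne

theorem quotient_mk_eq_iff {p q : Plane} :
    (QuotientAddGroup.mk p : Plane ⧸ blackLattice) = QuotientAddGroup.mk q ↔ IsBlack (p - q) := by
  rw [eq_comm, QuotientAddGroup.eq, mem_blackLattice, neg_add_eq_sub]

/-- In a tiling, there is an integral point that is congruent modulo the black points to all the
vertices of the tiles, except the right-angle vertices of the triangles, which are corners. -/
theorem IsTiling.exists_integral_representative {m n : ℕ} (hm : 2 ≤ m) (hn : 2 ≤ n)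
    {T : Set (Set Plane)} (hT : IsTiling m n T) :
    ∃ c, IsIntegralPoint c ∧ ∀ V ∈ T, ∀ p ∈ V, IsIntegralPoint (p - c) ∧
      (IsBlack (p - c) ∨ IsRightAngleVertex V p ∧ p ∈ rectCorners m n) := by
  classical
  have hdata : ∀ V : Set Plane, ∃ bw : (Fin 8 → ℝ) × Plane, V ∈ T → TileData m n V bw.1 bw.2 := by
    intro V
    by_cases hV : V ∈ T
    · obtain ⟨b, w, h⟩ := (hT.isTile V hV).exists_tileData
      exact ⟨(b, w), fun _ => h⟩
    · exact ⟨(0, 0), fun h => absurd h hV⟩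
  choose bw hbw using hdata
  have hfin := hT.finite
  have hsub : ∀ V ∈ T, poly (bw V).1 ⊆ rect m n := by
    intro V hV
    rw [← (hbw V hV).convexHull_eq, ← hT.cover]
    exact Set.subset_biUnion_of_mem (u := fun V => convexHull ℝ V) hV
  -- A tile has the class of its reference vertex modulo black points.
  have hclassed : ClassedTiling hfin.toFinset (fun V => (bw V).1) (rectBound m n)
      (QuotientAddGroup.mk : Plane → Plane ⧸ blackLattice)
      (fun V => QuotientAddGroup.mk (bw V).2) := by
    refine ⟨?_, ?_, ?_, ?_, sideLen_rectBound_nonneg hm hn, ?_⟩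
    · rw [poly_rectBound, ← hT.cover]
      simp only [Set.Finite.mem_toFinset]
      exact Set.iUnion₂_congr fun V hV => (hbw V hV).convexHull_eq
    · intro V hV W hW hVW
      rw [Set.Finite.coe_toFinset] at hV hW
      exact (hT.disjoint hV hW hVW).mono (hbw V hV).inner_subset_interior
        (hbw W hW).inner_subset_interior
    · intro V hV
      exact (hbw V (hfin.mem_toFinset.1 hV)).sideLen_nonneg
    · intro V hV
      exact (hbw V (hfin.mem_toFinset.1 hV)).inner_nonempty
    · intro V hV j
      rw [hfin.mem_toFinset] at hV
      have h := hbw V hV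
      by_cases h0 : sideLen (bw V).1 j = 0
      · exact Or.inl h0
      · right
        rcases (h.side j).resolve_left h0 with h1 | h1
        · exact Or.inl ⟨quotient_mk_eq_iff.2 h1.1, quotient_mk_eq_iff.2 h1.2⟩
        · right
          intro x hx
          have hv : ∀ i, vert (bw V).1 i ∈ poly (rectBound m n) := fun i => by
            rw [poly_rectBound]; exact hsub V hV (vert_mem_poly h.sideLen_nonneg i)
          rw [← poly_rectBound] at h1
          exact ell_ne_of_segment_subset_frontier (hv _) (hv _) h0 h1 hx
  have hm' : (2 : ℝ) ≤ m := by exact_mod_cast hm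
  have hn' : (2 : ℝ) ≤ n := by exact_mod_cast hn
  have horigin : (0 : Plane) ∈ rect m n := by
    simp only [rect, Set.mem_prod, Set.mem_Icc, Prod.fst_zero, Prod.snd_zero]
    refine ⟨⟨?_, ?_⟩, ?_, ?_⟩ <;> linarith
  have hext : (0 : Plane) ∈ (rect m n).extremePoints ℝ := by
    refine ⟨horigin, ?_⟩
    rintro ⟨x, y⟩ hp ⟨x', y'⟩ hq ⟨s, t, hs, ht, -, hst⟩
    simp only [rect, Set.mem_prod, Set.mem_Icc] at hp hq
    simp [Prod.ext_iff] at hst ⊢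
    have a1 := mul_nonneg hs.le hp.1.1
    have a2 := mul_nonneg ht.le hq.1.1
    have a3 := mul_nonneg hs.le hp.2.1
    have a4 := mul_nonneg ht.le hq.2.1
    have b1 : s * x = 0 := by linarith [hst.1]
    have b3 : s * y = 0 := by linarith [hst.2]
    exact ⟨(mul_eq_zero.1 b1).resolve_left hs.ne', (mul_eq_zero.1 b3).resolve_left hs.ne'⟩
  obtain ⟨V₀, hV₀, h0⟩ : ∃ V ∈ T, (0 : Plane) ∈ convexHull ℝ V := by
    have := horigin
    rw [← hT.cover] at this
    simpa using this
  -- An extreme point of `R` that lies in a tile is extreme in that tile, hence one of its vertices.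
  have h0V : (0 : Plane) ∈ V₀ := by
    refine extremePoints_convexHull_subset (𝕜 := ℝ) ?_
    refine inter_extremePoints_subset_extremePoints_of_subset ?_ ⟨h0, hext⟩
    rw [(hbw V₀ hV₀).convexHull_eq]
    exact hsub V₀ hV₀
  have hint := (hbw V₀ hV₀).integral 0 h0V
  rw [zero_sub] at hint
  -- The reference vertex of `V₀` differs from the vertex `0` by an integral vector, so it is
  -- integral.
  refine ⟨(bw V₀).2, by simpa using hint.neg, fun V hV p hp => ?_⟩
  have hcls := quotient_mk_eq_iff.1
    (hclassed.cls_eq (hfin.mem_toFinset.2 hV) (hfin.mem_toFinset.2 hV₀))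
  constructor
  · simpa using ((hbw V hV).integral p hp).add hcls.isIntegralPoint
  · refine ((hbw V hV).color p hp).imp_left fun h => ?_
    simpa using h.add hcls

/-! ### Black and white tilings are disjoint -/

theorem IsRightAngleVertex.axis_aligned {V : Set Plane} {p : Plane} (h : IsRightAngleVertex V p) :
    ∀ q ∈ V, q.1 = p.1 ∨ q.2 = p.2 := by
  obtain ⟨a, k, v, rfl, rfl⟩ := h
  rintro _ ⟨q, hq, rfl⟩
  simp only [Shape.corners, List.mem_cons, List.not_mem_nil, or_false] at hq
  rcases hq with rfl | rfl | rfl <;> induction k using fin_four_cases <;>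
    simp [place_zero, place_one, place_two, place_three]

/-- This prevents a tile from being vacuously both black and white. If every vertex were a
right-angle vertex, the ends of the hypotenuse of a triangle would share a coordinate. -/
theorem IsTile.exists_not_isRightAngleVertex {m n : ℕ} {V : Set Plane} (h : IsTile m n V) :
    ∃ p ∈ V, ¬ IsRightAngleVertex V p := by
  by_contra! hall
  obtain ⟨b, w, hd⟩ := h.exists_tileData
  have hne : vert b 0 ∈ V := by rw [hd.vertices]; exact Set.mem_range_self _
  obtain ⟨a, k, v, hV, -⟩ := hall _ hne
  have ha : (a : ℝ) ≠ 0 := by have := one_le_pnat a; linarith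
  have hq : place k v ((a : ℝ), 0) ∈ V := by rw [hV]; exact ⟨_, by simp [Shape.corners], rfl⟩
  have hr : place k v (0, (a : ℝ)) ∈ V := by rw [hV]; exact ⟨_, by simp [Shape.corners], rfl⟩
  have h2 := (hall _ hq).axis_aligned _ hr
  induction k using fin_four_cases <;>
    simp [place_zero, place_one, place_two, place_three, ha] at h2

end SpecialTiling

/-! ### The main theorem -/

theorem proposition1 (m n : ℕ) (hm : 2 ≤ m) (hn : 2 ≤ n) :
    (∀ T : Set (Set SpecialTiling.Plane), SpecialTiling.IsTiling m n T →
      (∀ V ∈ T, ∀ p ∈ V, SpecialTiling.IsIntegralPoint p) ∧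
      ((∀ V ∈ T, ∀ p ∈ V, p ∉ SpecialTiling.rectCorners m n → SpecialTiling.IsBlack p) ∨
        (∀ V ∈ T, ∀ p ∈ V, p ∉ SpecialTiling.rectCorners m n → SpecialTiling.IsWhite p))) ∧
    SpecialTiling.tilings m n = SpecialTiling.blackTilings m n ∪ SpecialTiling.whiteTilings m n ∧
    Disjoint (SpecialTiling.blackTilings m n) (SpecialTiling.whiteTilings m n) := by
  refine ⟨fun T hT => ?_, ?_, ?_⟩
  · obtain ⟨c, hc, h⟩ := hT.exists_integral_representative hm hn
    refine ⟨fun V hV p hp => by simpa using (h V hV p hp).1.add hc, ?_⟩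
    have hblack : ∀ V ∈ T, ∀ p ∈ V, p ∉ SpecialTiling.rectCorners m n →
        SpecialTiling.IsBlack (p - c) := fun V hV p hp hcor =>
      (h V hV p hp).2.resolve_right fun hr => hcor hr.2
    -- The colour of the representative `c` is the common colour of the vertices.
    refine hc.isBlack_or_isWhite.imp (fun hc V hV p hp hcor => ?_) fun hc V hV p hp hcor => ?_
    · simpa using (hblack V hV p hp hcor).add hc
    · simpa using (hblack V hV p hp hcor).add_isWhite hc
  · refine Set.Subset.antisymm (fun T hT => ?_) ?_
    · obtain ⟨c, hc, h⟩ := SpecialTiling.IsTiling.exists_integral_representative hm hn hT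
      have hblack : ∀ V ∈ T, ∀ p ∈ V, ¬ SpecialTiling.IsRightAngleVertex V p →
          SpecialTiling.IsBlack (p - c) := fun V hV p hp hcor =>
        (h V hV p hp).2.resolve_right fun hr => hcor hr.1
      refine hc.isBlack_or_isWhite.imp (fun hc => ⟨hT, fun V hV p hp hcor => ?_⟩)
        fun hc => ⟨hT, fun V hV p hp hcor => ?_⟩
      · simpa using (hblack V hV p hp hcor).add hc
      · simpa using (hblack V hV p hp hcor).add_isWhite hc
    · exact Set.union_subset (fun T hT => hT.1) fun T hT => hT.1
  · rw [Set.disjoint_left]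
    rintro T ⟨hT, hb⟩ ⟨-, hw⟩
    have hne : ∃ V, V ∈ T := by
      have hm' : (2 : ℝ) ≤ m := by exact_mod_cast hm
      have hn' : (2 : ℝ) ≤ n := by exact_mod_cast hn
      have horigin : ((0, 0) : SpecialTiling.Plane) ∈ SpecialTiling.rect m n := by
        simp only [SpecialTiling.rect, Set.mem_prod, Set.mem_Icc]
        refine ⟨⟨?_, ?_⟩, ?_, ?_⟩ <;> linarith
      rw [← hT.cover] at horigin
      obtain ⟨V, hV, -⟩ := Set.mem_iUnion₂.1 horigin
      exact ⟨V, hV⟩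
    obtain ⟨V, hV⟩ := hne
    obtain ⟨p, hp, hr⟩ := (hT.isTile V hV).exists_not_isRightAngleVertex
    exact (hb V hV p hp hr).not_isWhite (hw V hV p hp hr)
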